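/- Let $n\ge 1$ be an integer and let $Q\ge 1$ and $Q'$ be real numbers. Write $\langle f\rangle_I=\frac1{|I|}\int_I f$ for the average of $f$ over $I$. Let $A^d_{2,Q}([0,1]^n)$ be the class of (almost everywhere) positive functions $\varphi\in L^1([0,1]^n)$ such that $\langle\varphi\rangle_I\,\langle\varphi^{-1}\rangle_I\le Q$ for every dyadic subcube $I$ of $[0,1]^n$ (including $[0,1]^n$ itself), and let $A_{2,Q'}([0,1])$ be the class of (almost everywhere) positive functions $\psi\in L^1([0,1])$ such that $\langle\psi\rangle_I\,\langle\psi^{-1}\rangle_I\le Q'$ for every nondegenerate subinterval $I\subset[0,1]$. The monotonic rearrangement of a measurable function $\varphi\colon[0,1]^n\to\mathbb R$ is the (essentially unique) function $\varphi^*$ on $[0,1]$ that is non-increasing on $(0,1)$ and has the same distribution with respect to Lebesgue measure as $\varphi$. Then the operator $\varphi\mapsto\varphi^*$ maps $A^d_{2,Q}([0,1]^n)$ into $A_{2,Q'}([0,1])$ if and only if $$Q'\ \ge\ \frac{Q(2^n+1)^2-(2^n-1)^2}{2^{n+2}}.$$ -/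

import Mathlib

open MeasureTheory Set

/-- The closed dyadic subcubes of `[0,1]^n`: products of the intervals
`[m i / 2^k, (m i + 1) / 2^k]` with `0 ≤ m i < 2^k` (the unit cube itself is the case `k = 0`). -/
def dyadicSubcubes (n : ℕ) : Set (Set (Fin n → ℝ)) :=
  {I | ∃ (k : ℕ) (m : Fin n → ℕ), (∀ i, m i < 2 ^ k) ∧
    I = Icc (fun i => (m i : ℝ) / 2 ^ k) (fun i => ((m i : ℝ) + 1) / 2 ^ k)}

/-- The nondegenerate closed subintervals of `[0,1]`. -/
def unitSubintervals : Set (Set ℝ) :=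
  {I | ∃ a b : ℝ, 0 ≤ a ∧ a < b ∧ b ≤ 1 ∧ I = Icc a b}

/-- The functions `φ` on `J` that are positive (almost everywhere), summable together with `φ⁻¹`
(so that the averages below are genuine and finite), and satisfy `⟨φ⟩_I ⟨φ⁻¹⟩_I ≤ Q` for every
`I` in the family `𝓘`. -/
def muckenhouptA2 {X : Type*} [MeasureSpace X] (J : Set X) (𝓘 : Set (Set X)) (Q : ℝ) :
    Set (X → ℝ) :=
  {φ | (∀ᵐ x ∂(volume.restrict J), 0 < φ x) ∧ IntegrableOn φ J volume ∧
    IntegrableOn (fun x => (φ x)⁻¹) J volume ∧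
    ∀ I ∈ 𝓘, (⨍ x in I, φ x ∂volume) * (⨍ x in I, (φ x)⁻¹ ∂volume) ≤ Q}

/-- The dyadic Muckenhoupt class `A^d_{2,Q}([0,1]^n)`. -/
def dyadicA2 (n : ℕ) (Q : ℝ) : Set ((Fin n → ℝ) → ℝ) :=
  muckenhouptA2 (Icc 0 1) (dyadicSubcubes n) Q

/-- The Muckenhoupt class `A_{2,Q}([0,1])`. -/
def intervalA2 (Q : ℝ) : Set (ℝ → ℝ) :=
  muckenhouptA2 (Icc 0 1) unitSubintervals Q

/-- `ψ` is a monotonic (non-increasing) rearrangement on `[0,1]` of the function `φ` on `[0,1]^n`: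
it is non-increasing and has the same distribution as `φ`. Monotonicity is required away from
the two endpoints, where the rearrangement of an unbounded function has no finite value. -/
def IsMonotonicRearrangement {n : ℕ} (φ : (Fin n → ℝ) → ℝ) (ψ : ℝ → ℝ) : Prop :=
  AntitoneOn ψ (Ioo 0 1) ∧
    ProbabilityTheory.IdentDistrib φ ψ
      (volume.restrict (Icc (0 : Fin n → ℝ) 1)) (volume.restrict (Icc (0 : ℝ) 1))

/-- The monotonic rearrangement operator acts from the class `A` of functions on `[0,1]^n` to the
class `B` of functions on `[0,1]`: it is defined on every `φ ∈ A`, with values in `B`. -/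
def RearrangementActs {n : ℕ} (A : Set ((Fin n → ℝ) → ℝ)) (B : Set (ℝ → ℝ)) : Prop :=
  ∀ φ ∈ A, (∃ ψ, IsMonotonicRearrangement φ ψ) ∧ ∀ ψ, IsMonotonicRearrangement φ ψ → ψ ∈ B

/-! Put N = 2^n and attach to a cube or interval the point (average of the weight, average of its
inverse). Single values give points of the hyperbola x₁x₂ = 1; dyadic cubes give points with 1 ≤
x₁x₂ ≤ Q. The critical constant bounds x₁x₂ on the segment from a dyadic cube to one of its
children: the rest of the parent gives a point on the extension of that segment, where x₁x₂ ≥ 1 by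
Cauchy–Schwarz (`mul_lineMap_le_of_three_points`).

Sufficiency. Suppose the rearrangement ψ has a product above Q' on [a, b]. One coordinate of its
point p then exceeds the corresponding average over the whole cube; inverting φ and reversing ψ
makes it the first one. Let β = ψ b, let q be p scaled down slightly, and let `gain` be the affine
function vanishing at (β, β⁻¹) and q, evaluated on the hyperbola; `excess` is its part on values
above β. By monotonicity of ψ, the excess of ψ has positive integral, hence so has the excess of φ.
In the cube, however, stop at the maximal dyadic cubes where the integral of the gain is
nonpositive. They contribute nonpositively. Off them the averages stay above the line, start to the
left of q, and cannot jump past q, since the segment from parent to child would then pass above q,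
where the product exceeds Q'. So φ ≤ q₁ almost everywhere there, and the excess is again nonpositive
(`setIntegral_excess_nonpos`): a contradiction.

Necessity. A self-similar step function of the sup norm, with a ratio making its product exactly Q
on every corner cube, attains the constant on a suitable interval [0, b]. -/

/-! ### Plane geometry of averages. -/

/-- If the quadratic `t ↦ (x + t (z - x))₁ (x + t (z - x))₂` is at most `Q` at `t = 0` and `t = 1`
and at least `1` at `t = -1 / (N - 1)`, then it is at most `Q + (Q - 1) (N - 1)² / (4 N)` between
`0` and `1`. -/
lemma mul_lineMap_le_of_three_points {N Q x₁ x₂ z₁ z₂ t : ℝ} (hN : 1 < N) (hQ : 1 ≤ Q)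
    (hx : x₁ * x₂ ≤ Q) (hz : z₁ * z₂ ≤ Q)
    (hw : (N - 1) ^ 2 ≤ (N * x₁ - z₁) * (N * x₂ - z₂)) (ht0 : 0 ≤ t) (ht1 : t ≤ 1) :
    ((1 - t) * x₁ + t * z₁) * ((1 - t) * x₂ + t * z₂) ≤
      (Q * (N + 1) ^ 2 - (N - 1) ^ 2) / (4 * N) := by
  have hN0 : 0 < N := by linarith
  rw [le_div_iff₀ (by positivity)]
  have h1 : 0 ≤ t * (1 - t) := mul_nonneg ht0 (by linarith)
  -- Weighting `hw` by t(1 - t) eliminates the cross term x₁z₂ + x₂z₁. What is left is Q N + (Q -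
  -- 1)(N - 1)² t(1 - t), which is largest at t = 1/2.
  have hD := mul_le_mul_of_nonneg_left hw h1
  have hX : 0 ≤ ((1 - t) * N + t * (1 - t) * (N - 1) * N) * (Q - x₁ * x₂) := by
    refine mul_nonneg (add_nonneg (mul_nonneg (by linarith) hN0.le) ?_) (by linarith)
    exact mul_nonneg (mul_nonneg h1 (by linarith)) hN0.le
  have hZ : 0 ≤ (t * (1 + t * (N - 1))) * (Q - z₁ * z₂) := by
    refine mul_nonneg (mul_nonneg ht0 ?_) (by linarith)
    have := mul_nonneg ht0 (by linarith : (0 : ℝ) ≤ N - 1)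
    linarith
  have hT : 0 ≤ (Q - 1) * (N - 1) ^ 2 * (2 * t - 1) ^ 2 :=
    mul_nonneg (mul_nonneg (by linarith) (sq_nonneg _)) (sq_nonneg _)
  nlinarith

/-- Two points of a dyadic-type splitting that lie above a line through `(q₁, q₂)` are on the same
side of `(q₁, q₂)` as soon as `q₁ q₂` exceeds the critical value. -/
lemma fst_lt_of_three_points {N Q Q' x₁ x₂ z₁ z₂ q₁ q₂ s w : ℝ} (hN : 1 < N) (hQ : 1 ≤ Q)
    (hQ' : (Q * (N + 1) ^ 2 - (N - 1) ^ 2) / (4 * N) ≤ Q')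
    (hx : x₁ * x₂ ≤ Q) (hz : z₁ * z₂ ≤ Q)
    (hw : (N - 1) ^ 2 ≤ (N * x₁ - z₁) * (N * x₂ - z₂))
    (hq : Q' < q₁ * q₂) (hq₁ : 0 < q₁) (hw0 : 0 < w)
    (hLx : 0 < s * (x₁ - q₁) + w * (x₂ - q₂)) (hLz : 0 < s * (z₁ - q₁) + w * (z₂ - q₂))
    (hxq : x₁ < q₁) : z₁ < q₁ := by
  by_contra! hcon
  have hxz : 0 < z₁ - x₁ := by linarith
  -- The parameter at which the segment from x to z crosses the vertical line through q; the
  -- crossing point lies above q.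
  set t := (q₁ - x₁) / (z₁ - x₁) with ht
  have ht0 : 0 < t := div_pos (by linarith) hxz
  have ht1 : t ≤ 1 := (div_le_one hxz).2 (by linarith)
  have hy₁ : (1 - t) * x₁ + t * z₁ = q₁ := by
    rw [ht]; field_simp; ring
  have hL : 0 < w * (((1 - t) * x₂ + t * z₂) - q₂) := by
    have h1 := mul_nonneg (by linarith : 0 ≤ 1 - t) hLx.le
    have h2 := mul_pos ht0 hLz
    have h3 : s * ((1 - t) * x₁ + t * z₁ - q₁) = 0 := by rw [hy₁]; ring
    linarith
  have hy₂ : q₂ < (1 - t) * x₂ + t * z₂ := by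
    have := (mul_pos_iff_of_pos_left hw0).1 hL
    linarith
  have h := mul_lineMap_le_of_three_points hN hQ hx hz hw ht0.le ht1
  rw [hy₁] at h
  have := mul_lt_mul_of_pos_left hy₂ hq₁
  linarith

/-- Cauchy–Schwarz, from the discriminant of r ↦ ∫ (r φ - 1)² / φ ≥ 0. -/
lemma sq_measureReal_le_integral_mul_integral_inv {X : Type*} [MeasurableSpace X]
    {μ : Measure X} {A : Set X} {φ : X → ℝ} (hfin : μ A ≠ ⊤)
    (hpos : ∀ᵐ x ∂μ.restrict A, 0 < φ x) (hφ : IntegrableOn φ A μ)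
    (hφ' : IntegrableOn (fun x => (φ x)⁻¹) A μ) :
    μ.real A ^ 2 ≤ (∫ x in A, φ x ∂μ) * ∫ x in A, (φ x)⁻¹ ∂μ := by
  have key : ∀ r : ℝ, 0 ≤ (∫ x in A, φ x ∂μ) * (r * r) + (-2 * μ.real A) * r
      + ∫ x in A, (φ x)⁻¹ ∂μ := by
    intro r
    have hc : IntegrableOn (fun _ : X => -2 * r) A μ := integrableOn_const hfin
    have h1 : IntegrableOn (fun x => φ x * (r * r)) A μ := hφ.mul_const _
    have : (∫ x in A, φ x ∂μ) * (r * r) + (-2 * μ.real A) * r + ∫ x in A, (φ x)⁻¹ ∂μ =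
        ∫ x in A, (φ x * (r * r) + -2 * r) + (φ x)⁻¹ ∂μ := by
      have h2 : IntegrableOn (fun x => φ x * (r * r) + -2 * r) A μ := h1.add hc
      rw [integral_add h2 hφ', integral_add h1 hc, integral_mul_const, setIntegral_const,
        smul_eq_mul]
      ring
    rw [this]
    refine integral_nonneg_of_ae ?_
    filter_upwards [hpos] with x hx
    have : (φ x * (r * r) + -2 * r) + (φ x)⁻¹ = (φ x * r - 1) ^ 2 * (φ x)⁻¹ := by
      field_simp; ring
    rw [this]
    simp only [Pi.zero_apply]
    positivity
  have := discrim_le_zero key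
  unfold discrim at this
  nlinarith

/-! ### The gain and its truncation. -/

/-- The value at `(t, t⁻¹)` of the affine function vanishing at `(β, β⁻¹)` and `(q₁, q₂)`. -/
noncomputable def gain (β q₁ q₂ t : ℝ) : ℝ :=
  (β⁻¹ - q₂) * (t - β) + (q₁ - β) * (t⁻¹ - β⁻¹)

/-- The part of `gain` living on values above `β`. -/
noncomputable def excess (β q₁ q₂ t : ℝ) : ℝ := (Ioi β).indicator (gain β q₁ q₂) t

/-- The root β is split off, so the sign is decided by a factor that is nondecreasing in t when β <
q₁. -/
lemma gain_eq_mul {β q₁ q₂ t : ℝ} (hβ : 0 < β) (ht : 0 < t) :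
    gain β q₁ q₂ t = (t - β) * ((β⁻¹ - q₂) - (q₁ - β) / (t * β)) := by
  unfold gain; field_simp; ring

/-- To the left of β the hyperbola lies on or above the line, because q is above the hyperbola and
to the right of β. -/
lemma excess_le_gain {β q₁ q₂ t : ℝ} (hβ : 0 < β) (h₁ : β < q₁) (hq : 1 < q₁ * q₂)
    (ht : 0 < t) : excess β q₁ q₂ t ≤ gain β q₁ q₂ t := by
  unfold excess
  by_cases h : β < t
  · rw [indicator_of_mem (by exact h)]
  · rw [indicator_of_notMem (by exact h), gain_eq_mul hβ ht]
    push Not at h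
    refine mul_nonneg_of_nonpos_of_nonpos (by linarith) ?_
    rw [sub_nonpos, le_div_iff₀ (by positivity)]
    have : (β⁻¹ - q₂) * (t * β) = t * (1 - q₂ * β) := by field_simp
    rw [this]
    by_cases h3 : 0 ≤ 1 - q₂ * β
    · calc t * (1 - q₂ * β) ≤ β * (1 - q₂ * β) := by gcongr
        _ ≤ q₁ - β := by nlinarith
    · nlinarith [mul_pos ht (by linarith : 0 < -(1 - q₂ * β))]

/-- The line meets the hyperbola again only to the right of q₁, and between the two intersections
the hyperbola is below its chord. -/
lemma excess_nonpos {β q₁ q₂ t : ℝ} (hβ : 0 < β) (h₂ : q₂ < β⁻¹) (hq : 1 < q₁ * q₂)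
    (ht : t ≤ q₁) : excess β q₁ q₂ t ≤ 0 := by
  unfold excess
  refine indicator_apply_le' (fun h => ?_) (fun _ => le_rfl)
  have h : β < t := h
  rw [gain_eq_mul hβ (hβ.trans h)]
  refine mul_nonpos_of_nonneg_of_nonpos (by linarith) ?_
  have ht0 := hβ.trans h
  rw [sub_nonpos, le_div_iff₀ (by positivity)]
  have e : (β⁻¹ - q₂) * (t * β) = t * (1 - q₂ * β) := by field_simp
  have h3 : 0 < 1 - q₂ * β := by
    have := mul_lt_mul_of_pos_right h₂ hβ
    rw [inv_mul_cancel₀ hβ.ne'] at this; linarith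
  rw [e]
  calc t * (1 - q₂ * β) ≤ q₁ * (1 - q₂ * β) := by gcongr
    _ ≤ q₁ - β := by nlinarith

lemma gain_nonneg_of_le {β q₁ q₂ t t' : ℝ} (hβ : 0 < β) (h₁ : β < q₁) (ht : β ≤ t)
    (h : 0 < gain β q₁ q₂ t) (htt : t ≤ t') : 0 ≤ gain β q₁ q₂ t' := by
  rw [gain_eq_mul hβ (by linarith)] at h ⊢
  have h2 := pos_of_mul_pos_right h (by linarith : 0 ≤ t - β)
  refine mul_nonneg (by linarith) ?_
  have : (q₁ - β) / (t' * β) ≤ (q₁ - β) / (t * β) := by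
    have : 0 < t := by linarith
    gcongr
  linarith

lemma measurable_excess (β q₁ q₂ : ℝ) : Measurable (excess β q₁ q₂) := by
  have : Measurable (gain β q₁ q₂) := by unfold gain; fun_prop
  exact this.indicator measurableSet_Ioi

lemma integrableOn_gain {X : Type*} [MeasurableSpace X] {μ : Measure X} {A : Set X} {φ : X → ℝ}
    (hfin : μ A ≠ ⊤) (hφ : IntegrableOn φ A μ) (hφ' : IntegrableOn (fun x => (φ x)⁻¹) A μ)
    (β q₁ q₂ : ℝ) : IntegrableOn (fun x => gain β q₁ q₂ (φ x)) A μ := by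
  unfold gain
  exact ((hφ.sub (integrableOn_const hfin)).const_mul _).add
    ((hφ'.sub (integrableOn_const hfin)).const_mul _)

lemma integrableOn_excess {X : Type*} [MeasurableSpace X] {μ : Measure X} {A : Set X} {φ : X → ℝ}
    (hfin : μ A ≠ ⊤) (hφ : IntegrableOn φ A μ) (hφ' : IntegrableOn (fun x => (φ x)⁻¹) A μ)
    (β q₁ q₂ : ℝ) : IntegrableOn (fun x => excess β q₁ q₂ (φ x)) A μ := by
  refine Integrable.mono (integrableOn_gain hfin hφ hφ' β q₁ q₂)
    ((measurable_excess β q₁ q₂).comp_aemeasurable hφ.aemeasurable).aestronglyMeasurable ?_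
  exact .of_forall fun x => norm_indicator_le_norm_self _ _

lemma setIntegral_gain {X : Type*} [MeasurableSpace X] {μ : Measure X} {A : Set X} {φ : X → ℝ}
    (hfin : μ A ≠ ⊤) (hφ : IntegrableOn φ A μ) (hφ' : IntegrableOn (fun x => (φ x)⁻¹) A μ)
    (β q₁ q₂ : ℝ) : ∫ x in A, gain β q₁ q₂ (φ x) ∂μ =
      (β⁻¹ - q₂) * ((∫ x in A, φ x ∂μ) - q₁ * μ.real A) +
        (q₁ - β) * ((∫ x in A, (φ x)⁻¹ ∂μ) - q₂ * μ.real A) := by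
  unfold gain
  have c1 : IntegrableOn (fun _ : X => β) A μ := integrableOn_const hfin
  have c2 : IntegrableOn (fun _ : X => β⁻¹) A μ := integrableOn_const hfin
  have d1 : IntegrableOn (fun x => φ x - β) A μ := hφ.sub c1
  have d2 : IntegrableOn (fun x => (φ x)⁻¹ - β⁻¹) A μ := hφ'.sub c2
  rw [integral_add (d1.const_mul _) (d2.const_mul _), integral_const_mul,
    integral_const_mul, integral_sub hφ c1, integral_sub hφ' c2, setIntegral_const,
    setIntegral_const, smul_eq_mul, smul_eq_mul]
  ring

/-! ### Half-open dyadic cubes. -/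

/-- The half-open dyadic cube `∏ [m i / 2^k, (m i + 1) / 2^k)`. -/
def dyadicCell {n : ℕ} (k : ℕ) (m : Fin n → ℕ) : Set (Fin n → ℝ) :=
  univ.pi fun i => Ico ((m i : ℝ) / 2 ^ k) (((m i : ℝ) + 1) / 2 ^ k)

/-- The index of the dyadic cube of generation `k` containing `x`. -/
noncomputable def dyadicIndex {n : ℕ} (k : ℕ) (x : Fin n → ℝ) : Fin n → ℕ :=
  fun i => ⌊2 ^ k * x i⌋₊

lemma mem_dyadicCell_iff {n k : ℕ} {m : Fin n → ℕ} {x : Fin n → ℝ} :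
    x ∈ dyadicCell k m ↔ (∀ i, 0 ≤ x i) ∧ dyadicIndex k x = m := by
  have h2 : (0 : ℝ) < 2 ^ k := by positivity
  simp only [dyadicCell, mem_univ_pi, mem_Ico, funext_iff, dyadicIndex, ← forall_and]
  refine forall_congr' fun i => ?_
  rw [div_le_iff₀ h2, lt_div_iff₀ h2, mul_comm (x i)]
  constructor
  · rintro ⟨h, h'⟩
    have h0 : 0 ≤ 2 ^ k * x i := (Nat.cast_nonneg _).trans h
    exact ⟨(mul_nonneg_iff_of_pos_left h2).1 h0, (Nat.floor_eq_iff h0).2 ⟨h, h'⟩⟩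
  · rintro ⟨h, h'⟩
    exact (Nat.floor_eq_iff (by positivity)).1 h'

lemma dyadicIndex_of_le {n j k : ℕ} (h : j ≤ k) (x : Fin n → ℝ) :
    dyadicIndex j x = fun i => dyadicIndex k x i / 2 ^ (k - j) := by
  ext i
  have := Nat.floor_div_natCast (2 ^ k * x i) (2 ^ (k - j))
  rw [dyadicIndex, dyadicIndex, ← this]
  congr 1
  push_cast
  rw [eq_div_iff (by positivity), mul_right_comm, ← pow_add, Nat.add_sub_cancel' h]

lemma dyadicIndex_congr {n j k : ℕ} (h : j ≤ k) {x y : Fin n → ℝ}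
    (hxy : dyadicIndex k x = dyadicIndex k y) : dyadicIndex j x = dyadicIndex j y := by
  rw [dyadicIndex_of_le h, dyadicIndex_of_le h, hxy]

lemma dyadicCell_subset {n j k : ℕ} (h : j ≤ k) (x : Fin n → ℝ) :
    dyadicCell k (dyadicIndex k x) ⊆ dyadicCell j (dyadicIndex j x) := by
  intro y hy
  rw [mem_dyadicCell_iff] at hy ⊢
  exact ⟨hy.1, dyadicIndex_congr h hy.2⟩

lemma measurableSet_dyadicCell {n k : ℕ} (m : Fin n → ℕ) : MeasurableSet (dyadicCell k m) :=
  MeasurableSet.univ_pi fun _ => measurableSet_Ico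

lemma dyadicCell_ae_eq {n k : ℕ} (m : Fin n → ℕ) : dyadicCell k m =ᵐ[volume]
    Icc (fun i => (m i : ℝ) / 2 ^ k) (fun i => ((m i : ℝ) + 1) / 2 ^ k) := by
  rw [volume_pi]
  exact Measure.univ_pi_Ico_ae_eq_Icc

lemma measureReal_dyadicCell {n k : ℕ} (m : Fin n → ℕ) :
    volume.real (dyadicCell k m) = (((2 : ℝ) ^ n) ^ k)⁻¹ := by
  rw [dyadicCell, measureReal_def, Real.volume_pi_Ico_toReal]
  · simp [← sub_div, pow_right_comm]
  · intro i
    dsimp only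
    gcongr
    linarith

lemma volume_dyadicCell_ne_top {n k : ℕ} (m : Fin n → ℕ) : volume (dyadicCell k m) ≠ ⊤ := by
  rw [measure_congr (dyadicCell_ae_eq m)]
  exact isCompact_Icc.measure_ne_top

lemma dyadicCell_zero_ae_eq (n : ℕ) :
    dyadicCell 0 (0 : Fin n → ℕ) =ᵐ[volume] Icc (0 : Fin n → ℝ) 1 := by
  have := dyadicCell_ae_eq (k := 0) (0 : Fin n → ℕ)
  convert this using 2 <;> (simp; rfl)

lemma dyadicIndex_lt {n k : ℕ} {x : Fin n → ℝ} (hx : x ∈ dyadicCell 0 (0 : Fin n → ℕ)) (i : Fin n) :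
    dyadicIndex k x i < 2 ^ k := by
  have h := (mem_dyadicCell_iff.1 hx).2
  rw [dyadicIndex_of_le (Nat.zero_le k)] at h
  simpa [Nat.div_eq_zero_iff] using congrFun h i

lemma mem_dyadicCell_dyadicIndex {n : ℕ} {x : Fin n → ℝ} (hx : ∀ i, 0 ≤ x i) (k : ℕ) :
    x ∈ dyadicCell k (dyadicIndex k x) := mem_dyadicCell_iff.2 ⟨hx, rfl⟩

lemma dyadicIndex_zero {n : ℕ} {x : Fin n → ℝ} (hx : x ∈ dyadicCell 0 (0 : Fin n → ℕ)) :
    dyadicIndex 0 x = 0 := (mem_dyadicCell_iff.1 hx).2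

lemma dyadicCell_subset_unit {n k : ℕ} {x : Fin n → ℝ} (hx : x ∈ dyadicCell 0 (0 : Fin n → ℕ)) :
    dyadicCell k (dyadicIndex k x) ⊆ dyadicCell 0 (0 : Fin n → ℕ) := by
  have := dyadicCell_subset (Nat.zero_le k) x
  rwa [dyadicIndex_zero hx] at this

/-! ### The stopping argument in the cube. -/

/-- Stopping at the maximal dyadic cubes on which the integral of `g ≥ H` is nonpositive. -/
lemma setIntegral_nonpos_of_stopping {n : ℕ} {g H : (Fin n → ℝ) → ℝ}
    (hg : IntegrableOn g (dyadicCell 0 (0 : Fin n → ℕ)))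
    (hH : IntegrableOn H (dyadicCell 0 (0 : Fin n → ℕ)))
    (hle : ∀ᵐ x ∂volume.restrict (dyadicCell 0 (0 : Fin n → ℕ)), H x ≤ g x)
    (hrest : ∀ᵐ x ∂volume, x ∈ dyadicCell 0 (0 : Fin n → ℕ) →
      (∀ k, 0 < ∫ y in dyadicCell k (dyadicIndex k x), g y) → H x ≤ 0) :
    ∫ x in dyadicCell 0 (0 : Fin n → ℕ), H x ≤ 0 := by
  set U := dyadicCell 0 (0 : Fin n → ℕ) with hU
  have hUm : MeasurableSet U := measurableSet_dyadicCell _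
  -- Points whose first stopping cube is `p`. The condition depends only on ancestors of the cube,
  -- so each `A p` is empty or the entire cell.
  let A : ℕ × (Fin n → ℕ) → Set (Fin n → ℝ) := fun p =>
    {x | x ∈ U ∧ dyadicIndex p.1 x = p.2 ∧ ∫ y in dyadicCell p.1 p.2, g y ≤ 0 ∧
      ∀ j < p.1, 0 < ∫ y in dyadicCell j (dyadicIndex j x), g y}
  have hA : ∀ p, A p = ∅ ∨ (A p = dyadicCell p.1 p.2 ∧ dyadicCell p.1 p.2 ⊆ U ∧
      ∫ y in dyadicCell p.1 p.2, g y ≤ 0) := by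
    intro p
    rcases (A p).eq_empty_or_nonempty with h | ⟨x, hx⟩
    · exact Or.inl h
    obtain ⟨hxU, hxp, hle0, hlt⟩ := hx
    have hsub : dyadicCell p.1 p.2 ⊆ U := by
      rw [← hxp]; exact dyadicCell_subset_unit hxU
    refine Or.inr ⟨Subset.antisymm ?_ ?_, hsub, hle0⟩
    · rintro y ⟨hyU, hyp, -, -⟩
      exact mem_dyadicCell_iff.2 ⟨(mem_dyadicCell_iff.1 hyU).1, hyp⟩
    · intro y hy
      have hyp := (mem_dyadicCell_iff.1 hy).2
      refine ⟨hsub hy, hyp, hle0, fun j hj => ?_⟩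
      rw [dyadicIndex_congr hj.le (hyp.trans hxp.symm)]
      exact hlt j hj
  have hAm : ∀ p, MeasurableSet (A p) := by
    intro p
    rcases hA p with h | ⟨h, -⟩
    · rw [h]; exact MeasurableSet.empty
    · rw [h]; exact measurableSet_dyadicCell _
  have hAU : ⋃ p, A p ⊆ U := iUnion_subset fun p x hx => hx.1
  have hdisj : Pairwise (Function.onFun Disjoint A) := by
    rintro ⟨k, m⟩ ⟨k', m'⟩ hne
    refine disjoint_left.2 fun x hx hx' => hne ?_
    obtain ⟨-, h1, h2, h3⟩ := hx
    obtain ⟨-, h1', h2', h3'⟩ := hx'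
    dsimp only at h1 h2 h3 h1' h2' h3'
    subst h1 h1'
    rcases lt_trichotomy k k' with h | h | h
    · exact absurd h2 (h3' k h).not_ge
    · rw [h]
    · exact absurd h2' (h3 k' h).not_ge
  have hint : IntegrableOn H (⋃ p, A p) := hH.mono_set hAU
  rw [← union_sdiff_cancel hAU, setIntegral_union disjoint_sdiff_right
    (hUm.diff (MeasurableSet.iUnion hAm)) hint (hH.mono_set sdiff_subset)]
  refine add_nonpos ?_ ?_
  · rw [integral_iUnion hAm hdisj hint]
    refine tsum_nonpos fun p => ?_
    rcases hA p with h | ⟨h, hsub, h0⟩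
    · simp [h]
    · rw [h]
      refine le_trans (integral_mono_ae (hH.mono_set hsub) (hg.mono_set hsub) ?_) h0
      exact ae_restrict_of_ae_restrict_of_subset hsub hle
  · refine setIntegral_nonpos_ae (hUm.diff (MeasurableSet.iUnion hAm)) ?_
    filter_upwards [hrest] with x hx hxR
    refine hx hxR.1 fun k => ?_
    by_contra! hk
    refine hxR.2 ?_
    classical
    have hex : ∃ k, ∫ y in dyadicCell k (dyadicIndex k x), g y ≤ 0 := ⟨k, hk⟩
    refine mem_iUnion.2 ⟨(Nat.find hex, dyadicIndex (Nat.find hex) x), hxR.1, rfl,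
      Nat.find_spec hex, fun j hj => ?_⟩
    exact not_le.1 (Nat.find_min hex hj)

/-- Lebesgue differentiation along dyadic cubes. -/
lemma ae_tendsto_dyadicCell_average {n : ℕ} {f : (Fin n → ℝ) → ℝ}
    (hf : IntegrableOn f (dyadicCell 0 (0 : Fin n → ℕ))) :
    ∀ᵐ x ∂volume, x ∈ dyadicCell 0 (0 : Fin n → ℕ) → Filter.Tendsto
      (fun k => ⨍ y in dyadicCell k (dyadicIndex k x), f y) Filter.atTop (nhds (f x)) := by
  set U := dyadicCell 0 (0 : Fin n → ℕ) with hU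
  have hUm : MeasurableSet U := measurableSet_dyadicCell _
  have hf' : LocallyIntegrable (U.indicator f) volume :=
    ((integrable_indicator_iff hUm).2 hf).locallyIntegrable
  filter_upwards [IsUnifLocDoublingMeasure.ae_tendsto_average volume hf' 1] with x hx hxU
  have hδ : Filter.Tendsto (fun k : ℕ => ((1 : ℝ) / 2) ^ (k + 1)) Filter.atTop
      (nhdsWithin 0 (Ioi 0)) := by
    refine tendsto_nhdsWithin_iff.2 ⟨?_, .of_forall fun k => by simp⟩
    exact (tendsto_pow_atTop_nhds_zero_of_lt_one (by norm_num) (by norm_num)).comp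
      (Filter.tendsto_add_atTop_nat 1)
  -- Closed dyadic cubes are sup-norm balls about their centres; the differentiation theorem allows
  -- centres other than x.
  have hball : ∀ k, Metric.closedBall (fun i => ((dyadicIndex k x i : ℝ) + 1 / 2) / 2 ^ k)
      ((1 / 2 : ℝ) ^ (k + 1)) = Icc (fun i => (dyadicIndex k x i : ℝ) / 2 ^ k)
        (fun i => ((dyadicIndex k x i : ℝ) + 1) / 2 ^ k) := by
    intro k
    rw [closedBall_pi _ (by positivity), ← pi_univ_Icc]
    congr 1
    ext1 i
    rw [Real.Icc_eq_closedBall]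
    congr 1
    · ring
    · rw [pow_succ, one_div_pow]; ring
  have hmem : ∀ k, x ∈ Icc (fun i => (dyadicIndex k x i : ℝ) / 2 ^ k)
        (fun i => ((dyadicIndex k x i : ℝ) + 1) / 2 ^ k) := by
    intro k
    have := mem_dyadicCell_dyadicIndex (mem_dyadicCell_iff.1 hxU).1 k
    rw [dyadicCell, mem_univ_pi] at this
    exact ⟨fun i => (this i).1, fun i => (this i).2.le⟩
  have := hx _ _ hδ (.of_forall fun k => by rw [one_mul, hball k]; exact hmem k)
  rw [indicator_of_mem hxU] at this
  refine this.congr fun k => ?_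
  rw [hball, ← setAverage_congr (dyadicCell_ae_eq _)]
  rw [setAverage_eq, setAverage_eq]
  congr 1
  refine setIntegral_congr_fun (measurableSet_dyadicCell _) fun y hy => ?_
  exact indicator_of_mem (dyadicCell_subset_unit hxU hy) f

lemma integral_mul_integral_inv_dyadicCell_le {n : ℕ} {Q : ℝ} {φ : (Fin n → ℝ) → ℝ}
    (hφ : φ ∈ dyadicA2 n Q) (k : ℕ) {x : Fin n → ℝ} (hx : x ∈ dyadicCell 0 (0 : Fin n → ℕ)) :
    ((2 ^ n) ^ k * ∫ y in dyadicCell k (dyadicIndex k x), φ y) *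
      ((2 ^ n) ^ k * ∫ y in dyadicCell k (dyadicIndex k x), (φ y)⁻¹) ≤ Q := by
  have h := hφ.2.2.2 _ ⟨k, dyadicIndex k x, dyadicIndex_lt hx, rfl⟩
  rw [← setAverage_congr (dyadicCell_ae_eq _), ← setAverage_congr (dyadicCell_ae_eq _),
    setAverage_eq, setAverage_eq, measureReal_dyadicCell, inv_inv] at h
  simpa using h

/-- The part of a dyadic `A₂` weight exceeding `β` carries nonpositive gain. -/
theorem setIntegral_excess_nonpos {n : ℕ} (hn : 1 ≤ n) {Q Q' β q₁ q₂ : ℝ} (hQ : 1 ≤ Q)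
    (hQ' : (Q * (2 ^ n + 1) ^ 2 - (2 ^ n - 1) ^ 2) / (4 * 2 ^ n) ≤ Q')
    {φ : (Fin n → ℝ) → ℝ} (hφ : φ ∈ dyadicA2 n Q) (hβ : 0 < β) (h₁ : β < q₁) (h₂ : q₂ < β⁻¹)
    (hq : Q' < q₁ * q₂) (hq' : 1 < q₁ * q₂) (hx₀ : ∫ x in Icc 0 1, φ x < q₁) :
    ∫ x in Icc 0 1, excess β q₁ q₂ (φ x) ≤ 0 := by
  have hN : (1 : ℝ) < 2 ^ n := one_lt_pow₀ (by norm_num) (by omega)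
  rw [← setIntegral_congr_set (dyadicCell_zero_ae_eq n)] at hx₀ ⊢
  set U := dyadicCell 0 (0 : Fin n → ℕ) with hU
  have hres : volume.restrict (Icc (0 : Fin n → ℝ) 1) = volume.restrict U :=
    Measure.restrict_congr_set (dyadicCell_zero_ae_eq n).symm
  have hpos : ∀ᵐ x ∂volume.restrict U, 0 < φ x := hres ▸ hφ.1
  have hi : IntegrableOn φ U := by have := hφ.2.1; rwa [IntegrableOn, hres] at this
  have hi' : IntegrableOn (fun x => (φ x)⁻¹) U := by
    have := hφ.2.2.1; rwa [IntegrableOn, hres] at this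
  have hUtop : volume U ≠ ⊤ := volume_dyadicCell_ne_top _
  refine setIntegral_nonpos_of_stopping (integrableOn_gain hUtop hi hi' β q₁ q₂)
    (integrableOn_excess hUtop hi hi' β q₁ q₂) ?_ ?_
  · filter_upwards [hpos] with x hx using excess_le_gain hβ h₁ hq' hx
  filter_upwards [ae_tendsto_dyadicCell_average hi] with x hx hxU hpos_gain
  refine excess_nonpos hβ h₂ hq' (le_of_tendsto' (hx hxU) fun k => ?_)
  have key : ∀ k, (2 ^ n) ^ k * ∫ y in dyadicCell k (dyadicIndex k x), φ y < q₁ := by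
    intro k
    have hL : ∀ k, 0 < (β⁻¹ - q₂) *
          ((2 ^ n) ^ k * (∫ y in dyadicCell k (dyadicIndex k x), φ y) - q₁) +
        (q₁ - β) * ((2 ^ n) ^ k * (∫ y in dyadicCell k (dyadicIndex k x), (φ y)⁻¹) - q₂) := by
      intro k
      have hsub : dyadicCell k (dyadicIndex k x) ⊆ U := dyadicCell_subset_unit hxU
      have h := hpos_gain k
      rw [setIntegral_gain (volume_dyadicCell_ne_top _) (hi.mono_set hsub) (hi'.mono_set hsub),
        measureReal_dyadicCell] at h
      have hk : (0 : ℝ) < (2 ^ n) ^ k := by positivity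
      have e := mul_inv_cancel₀ hk.ne'
      generalize ((2 : ℝ) ^ n) ^ k = V at hk h e ⊢
      have := mul_pos hk h
      linear_combination this - ((β⁻¹ - q₂) * q₁ + (q₁ - β) * q₂) * e
    induction k with
    | zero => rw [dyadicIndex_zero hxU, pow_zero, one_mul]; exact hx₀
    | succ k ih =>
      -- Parent and child play x and z. The remaining goal is Cauchy–Schwarz on parent minus child,
      -- rescaled by N^(k+1).
      refine fst_lt_of_three_points hN hQ hQ' (integral_mul_integral_inv_dyadicCell_le hφ k hxU)
        (integral_mul_integral_inv_dyadicCell_le hφ (k + 1) hxU) ?_ hq (hβ.trans h₁)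
        (sub_pos.2 h₁) (hL k) (hL (k + 1)) ih
      set I := dyadicCell k (dyadicIndex k x) with hI
      set J := dyadicCell (k + 1) (dyadicIndex (k + 1) x) with hJ
      have hIU : I ⊆ U := dyadicCell_subset_unit hxU
      have hJI : J ⊆ I := dyadicCell_subset (Nat.le_succ k) x
      have hJm : MeasurableSet J := measurableSet_dyadicCell _
      have hdU : I \ J ⊆ U := sdiff_subset.trans hIU
      have hcs := sq_measureReal_le_integral_mul_integral_inv (A := I \ J)
        (measure_ne_top_of_subset hdU hUtop)
        (ae_restrict_of_ae_restrict_of_subset hdU hpos) (hi.mono_set hdU) (hi'.mono_set hdU)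
      rw [setIntegral_sdiff hJm (hi.mono_set hIU) hJI, setIntegral_sdiff hJm (hi'.mono_set hIU) hJI,
        measureReal_sdiff hJI hJm (measure_ne_top_of_subset hIU hUtop),
        measureReal_dyadicCell, measureReal_dyadicCell] at hcs
      have hk : (0 : ℝ) < (2 ^ n) ^ (k + 1) := by positivity
      have := mul_le_mul_of_nonneg_left hcs (by positivity : (0 : ℝ) ≤ ((2 ^ n) ^ (k + 1)) ^ 2)
      have e : ((2 : ℝ) ^ n - 1) ^ 2 =
          ((2 ^ n) ^ (k + 1)) ^ 2 * (((2 ^ n) ^ k)⁻¹ - ((2 ^ n) ^ (k + 1))⁻¹) ^ 2 := by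
        rw [← mul_pow, mul_sub, mul_inv_cancel₀ hk.ne', pow_succ (2 ^ n : ℝ) k, mul_right_comm,
          mul_inv_cancel₀ (by positivity), one_mul]
      rw [e]
      exact this.trans_eq (by ring)
  rw [setAverage_eq, measureReal_dyadicCell, inv_inv, smul_eq_mul]
  exact (key k).le

/-- The class of dyadic `A₂` weights is invariant under inversion. -/
lemma inv_mem_dyadicA2 {n : ℕ} {Q : ℝ} {φ : (Fin n → ℝ) → ℝ} (hφ : φ ∈ dyadicA2 n Q) :
    (fun x => (φ x)⁻¹) ∈ dyadicA2 n Q := by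
  refine ⟨hφ.1.mono fun x hx => inv_pos.2 hx, hφ.2.2.1, by simpa using hφ.2.1, fun I hI => ?_⟩
  simpa [mul_comm] using hφ.2.2.2 I hI

/-! ### Transfer to the rearrangement. -/

namespace IsMonotonicRearrangement

variable {n : ℕ} {φ : (Fin n → ℝ) → ℝ} {ψ : ℝ → ℝ}

lemma integrableOn (h : IsMonotonicRearrangement φ ψ) (hφ : IntegrableOn φ (Icc 0 1)) :
    IntegrableOn ψ (Icc 0 1) := h.2.integrable_iff.1 hφ

lemma identDistrib_inv (h : IsMonotonicRearrangement φ ψ) :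
    ProbabilityTheory.IdentDistrib (fun x => (φ x)⁻¹) (fun t => (ψ t)⁻¹)
      (volume.restrict (Icc (0 : Fin n → ℝ) 1)) (volume.restrict (Icc (0 : ℝ) 1)) :=
  h.2.comp measurable_inv

lemma integrableOn_inv (h : IsMonotonicRearrangement φ ψ)
    (hφ : IntegrableOn (fun x => (φ x)⁻¹) (Icc 0 1)) :
    IntegrableOn (fun t => (ψ t)⁻¹) (Icc 0 1) := h.identDistrib_inv.integrable_iff.1 hφ

lemma ae_pos (h : IsMonotonicRearrangement φ ψ)
    (hφ : ∀ᵐ x ∂volume.restrict (Icc (0 : Fin n → ℝ) 1), 0 < φ x) :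
    ∀ᵐ t ∂volume.restrict (Icc (0 : ℝ) 1), 0 < ψ t := h.2.ae_snd measurableSet_Ioi hφ

lemma pos (h : IsMonotonicRearrangement φ ψ)
    (hφ : ∀ᵐ x ∂volume.restrict (Icc (0 : Fin n → ℝ) 1), 0 < φ x) {t : ℝ} (ht : t ∈ Ioo (0 : ℝ) 1) :
    0 < ψ t := by
  -- Positivity at almost every point passes to every interior t: some positive value occurs to the
  -- right of t, and ψ is non-increasing.
  have h1 : ∀ᵐ s ∂volume.restrict (Ioo t 1), 0 < ψ s :=
    ae_restrict_of_ae_restrict_of_subset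
      (Ioo_subset_Icc_self.trans (Icc_subset_Icc_left ht.1.le)) (h.ae_pos hφ)
  have : (ae (volume.restrict (Ioo t 1))).NeBot := by
    rw [ae_restrict_neBot]; simp [ht.2]
  obtain ⟨s, hs, hs'⟩ := (h1.and (ae_restrict_mem measurableSet_Ioo)).exists
  exact hs.trans_le (h.1 ht ⟨ht.1.trans hs'.1, hs'.2⟩ hs'.1.le)

/-- Reversal `ψ ↦ 1 / ψ (1 - ·)` turns a rearrangement of `φ` into one of `1 / φ`. -/
lemma inv_comp_one_sub (h : IsMonotonicRearrangement φ ψ)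
    (hφ : ∀ᵐ x ∂volume.restrict (Icc (0 : Fin n → ℝ) 1), 0 < φ x) :
    IsMonotonicRearrangement (fun x => (φ x)⁻¹) (fun t => (ψ (1 - t))⁻¹) := by
  refine ⟨fun x hx y hy hxy => ?_, ?_⟩
  · have hx' : 1 - x ∈ Ioo (0 : ℝ) 1 := ⟨by linarith [hx.2], by linarith [hx.1]⟩
    have hy' : 1 - y ∈ Ioo (0 : ℝ) 1 := ⟨by linarith [hy.2], by linarith [hy.1]⟩
    exact inv_anti₀ (h.pos hφ hx') (h.1 hy' hx' (by linarith))
  · have hmp : MeasurePreserving (fun t : ℝ => 1 - t) (volume.restrict (Icc (0 : ℝ) 1))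
        (volume.restrict (Icc (0 : ℝ) 1)) := by
      have := (Measure.measurePreserving_sub_left (volume : Measure ℝ) 1).restrict_preimage
        (measurableSet_Icc : MeasurableSet (Icc (0 : ℝ) 1))
      simpa using this
    have hi := h.identDistrib_inv
    refine ⟨hi.aemeasurable_fst, hi.aemeasurable_snd.comp_quasiMeasurePreserving
      hmp.quasiMeasurePreserving, ?_⟩
    rw [hi.map_eq, ← hmp.map_eq, AEMeasurable.map_map_of_aemeasurable, hmp.map_eq]
    · rfl
    · rw [hmp.map_eq]; exact hi.aemeasurable_snd
    · exact hmp.measurable.aemeasurable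

/-- The `A₂` bound on an interval where the average exceeds the total average. -/
lemma integral_mul_integral_inv_le_of_lt (h : IsMonotonicRearrangement φ ψ) (hn : 1 ≤ n)
    {Q Q' : ℝ} (hQ : 1 ≤ Q)
    (hQ' : (Q * (2 ^ n + 1) ^ 2 - (2 ^ n - 1) ^ 2) / (4 * 2 ^ n) ≤ Q')
    (hφ : φ ∈ dyadicA2 n Q) {a b : ℝ} (ha : 0 < a) (hab : a < b) (hb : b < 1)
    (hx₀ : (b - a) * ∫ x in Icc 0 1, φ x < ∫ t in Icc a b, ψ t) :
    (∫ t in Icc a b, ψ t) * (∫ t in Icc a b, (ψ t)⁻¹) ≤ Q' * (b - a) ^ 2 := by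
  have hba : 0 < b - a := by linarith
  have hQ'1 : 1 ≤ Q' := by
    refine le_trans ?_ hQ'
    rw [le_div_iff₀ (by positivity)]
    nlinarith [sq_nonneg ((2 : ℝ) ^ n + 1)]
  have hsub : Icc a b ⊆ Icc 0 1 := Icc_subset_Icc ha.le hb.le
  have hsub' : Icc a b ⊆ Ioo 0 1 := fun t ht => ⟨ha.trans_le ht.1, ht.2.trans_lt hb⟩
  have hi := h.integrableOn hφ.2.1
  have hi' := h.integrableOn_inv hφ.2.2.1
  have hb' : b ∈ Ioo (0 : ℝ) 1 := ⟨ha.trans hab, hb⟩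
  have hβ : 0 < ψ b := h.pos hφ.1 hb'
  have hvol : volume.real (Icc a b) = b - a := by simp [hab.le]
  set β := ψ b with hβdef
  set x₀ := ∫ x in Icc 0 1, φ x with hx₀def
  obtain ⟨p₁, hp₁⟩ : ∃ p₁, ∫ t in Icc a b, ψ t = (b - a) * p₁ :=
    ⟨(∫ t in Icc a b, ψ t) / (b - a), by field_simp⟩
  obtain ⟨p₂, hp₂⟩ : ∃ p₂, ∫ t in Icc a b, (ψ t)⁻¹ = (b - a) * p₂ :=
    ⟨(∫ t in Icc a b, (ψ t)⁻¹) / (b - a), by field_simp⟩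
  have hge : ∀ t ∈ Icc a b, β ≤ ψ t := fun t ht => h.1 (hsub' ht) hb' ht.2
  have hp₁β : β ≤ p₁ := by
    have := setIntegral_mono_on (integrableOn_const (by simp)) (hi.mono_set hsub)
      measurableSet_Icc hge
    rw [setIntegral_const, hvol, hp₁, smul_eq_mul] at this
    exact le_of_mul_le_mul_left this hba
  have hp₂β : p₂ ≤ β⁻¹ := by
    have := setIntegral_mono_on (hi'.mono_set hsub) (integrableOn_const (by simp))
      measurableSet_Icc (fun t ht => inv_anti₀ hβ (hge t ht))
    rw [setIntegral_const, hvol, hp₂, smul_eq_mul] at this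
    exact le_of_mul_le_mul_left this hba
  have hx₁ : x₀ < p₁ := by
    rw [hp₁] at hx₀
    exact lt_of_mul_lt_mul_left hx₀ hba.le
  rw [hp₁, hp₂]
  by_contra! hcon
  have hp : Q' < p₁ * p₂ := by
    have : Q' * (b - a) ^ 2 < (p₁ * p₂) * (b - a) ^ 2 := by linarith
    exact lt_of_mul_lt_mul_right this (by positivity)
  have hp₁0 : 0 < p₁ := hβ.trans_le hp₁β
  have hp₂0 : 0 < p₂ := (pos_iff_pos_of_mul_pos (by linarith : 0 < p₁ * p₂)).1 hp₁0
  have hp₁β' : β < p₁ := by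
    have h1 : p₁ * p₂ ≤ p₁ * β⁻¹ := mul_le_mul_of_nonneg_left hp₂β hp₁0.le
    have h2 : 1 < p₁ * β⁻¹ := by linarith
    rwa [← div_eq_mul_inv, one_lt_div hβ] at h2
  have htend : ∀ {f : ℝ → ℝ}, Continuous f →
      Filter.Tendsto f (nhdsWithin 1 (Iio 1)) (nhds (f 1)) := fun hf =>
    (hf.tendsto 1).mono_left nhdsWithin_le_nhds
  -- Scaling p down to q = c p keeps the strict inequalities and puts p strictly on the positive
  -- side of the line.
  obtain ⟨c, ⟨⟨hc1, hcq⟩, hcx, hcβ⟩, hc⟩ : ∃ c, ((c < 1 ∧ Q' < (c * p₁) * (c * p₂)) ∧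
      x₀ < c * p₁ ∧ β < c * p₁) ∧ 0 < c := by
    refine Filter.Eventually.exists (f := nhdsWithin (1 : ℝ) (Iio 1)) ?_
    refine ((Filter.Eventually.and self_mem_nhdsWithin ?_).and (Filter.Eventually.and ?_ ?_)).and ?_
    · exact (htend (f := fun c => (c * p₁) * (c * p₂)) (by fun_prop)).eventually_const_lt
        (by simpa using hp)
    · exact (htend (f := fun c => c * p₁) (by fun_prop)).eventually_const_lt (by simpa using hx₁)
    · exact (htend (f := fun c => c * p₁) (by fun_prop)).eventually_const_lt (by simpa using hp₁β')
    · exact (htend (f := fun c => c) (by fun_prop)).eventually_const_lt one_pos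
  have hq₂ : c * p₂ < β⁻¹ := lt_of_lt_of_le (by nlinarith) hp₂β
  have hmain := setIntegral_excess_nonpos hn hQ hQ' hφ hβ hcβ hq₂ hcq (by linarith) hcx
  have hid := (h.2.comp (measurable_excess β (c * p₁) (c * p₂))).integral_eq
  simp only [Function.comp_apply] at hid
  rw [hid] at hmain
  have htop : volume (Icc (0 : ℝ) 1) ≠ ⊤ := by simp
  have htop' : volume (Icc a b) ≠ ⊤ := by simp
  have hgain : 0 < ∫ t in Icc a b, gain β (c * p₁) (c * p₂) (ψ t) := by
    rw [setIntegral_gain htop' (hi.mono_set hsub) (hi'.mono_set hsub), hvol, hp₁, hp₂]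
    have e1 : 0 < (β⁻¹ - c * p₂) * ((b - a) * p₁ - c * p₁ * (b - a)) := by
      refine mul_pos (by linarith) ?_
      have : (b - a) * p₁ - c * p₁ * (b - a) = (b - a) * p₁ * (1 - c) := by ring
      rw [this]
      exact mul_pos (mul_pos hba hp₁0) (by linarith)
    have e2 : 0 < (c * p₁ - β) * ((b - a) * p₂ - c * p₂ * (b - a)) := by
      refine mul_pos (by linarith) ?_
      have : (b - a) * p₂ - c * p₂ * (b - a) = (b - a) * p₂ * (1 - c) := by ring
      rw [this]
      exact mul_pos (mul_pos hba hp₂0) (by linarith)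
    linarith
  obtain ⟨t₀, ht₀, ht₀pos⟩ : ∃ t₀ ∈ Icc a b, 0 < gain β (c * p₁) (c * p₂) (ψ t₀) := by
    by_contra! hno
    exact absurd (setIntegral_nonpos measurableSet_Icc hno) hgain.not_ge
  have heq : ∫ t in Icc a b, excess β (c * p₁) (c * p₂) (ψ t) =
      ∫ t in Icc a b, gain β (c * p₁) (c * p₂) (ψ t) := by
    refine setIntegral_congr_fun measurableSet_Icc fun t ht => ?_
    rcases (hge t ht).eq_or_lt with h0 | h0
    · simp [excess, ← h0, gain]
    · exact indicator_of_mem (show ψ t ∈ Ioi β from h0) _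
  -- To the right of b, ψ ≤ β and the excess vanishes; to the left of a, ψ is at least ψ t₀, where
  -- the gain is already positive.
  have hoff : 0 ≤ ∫ t in Icc (0 : ℝ) 1 \ Icc a b, excess β (c * p₁) (c * p₂) (ψ t) := by
    refine setIntegral_nonneg_ae (measurableSet_Icc.diff measurableSet_Icc) ?_
    have hne : ∀ y : ℝ, ∀ᵐ t : ℝ, t ≠ y := fun y => by simp [ae_iff]
    filter_upwards [hne 0, hne 1] with t h0 h1 ht
    have ht' : t ∈ Ioo (0 : ℝ) 1 := ⟨lt_of_le_of_ne ht.1.1 h0.symm, lt_of_le_of_ne ht.1.2 h1⟩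
    refine indicator_apply_nonneg fun (hlt : β < ψ t) => ?_
    have hta : t < a := by
      by_contra! hat
      have hbt : b < t := by
        by_contra! hbt
        exact ht.2 ⟨hat, hbt⟩
      exact absurd (h.1 hb' ht' hbt.le) hlt.not_ge
    exact gain_nonneg_of_le hβ hcβ (hge t₀ ht₀) ht₀pos
      (h.1 ht' (hsub' ht₀) (hta.le.trans ht₀.1))
  rw [setIntegral_sdiff measurableSet_Icc (integrableOn_excess htop hi hi' _ _ _) hsub] at hoff
  linarith

lemma intervalIntegral_mul_intervalIntegral_inv_le (h : IsMonotonicRearrangement φ ψ) (hn : 1 ≤ n)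
    {Q Q' : ℝ} (hQ : 1 ≤ Q)
    (hQ' : (Q * (2 ^ n + 1) ^ 2 - (2 ^ n - 1) ^ 2) / (4 * 2 ^ n) ≤ Q')
    (hφ : φ ∈ dyadicA2 n Q) {a b : ℝ} (ha : 0 < a) (hab : a < b) (hb : b < 1) :
    (∫ t in a..b, ψ t) * (∫ t in a..b, (ψ t)⁻¹) ≤ Q' * (b - a) ^ 2 := by
  have hI : ∀ f : ℝ → ℝ, ∀ c d : ℝ, c ≤ d → ∫ t in c..d, f t = ∫ t in Icc c d, f t := by
    intro f c d hcd
    rw [intervalIntegral.integral_of_le hcd, integral_Icc_eq_integral_Ioc]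
  rw [hI _ _ _ hab.le, hI _ _ _ hab.le]
  by_cases h1 : (b - a) * ∫ x in Icc 0 1, φ x < ∫ t in Icc a b, ψ t
  · exact h.integral_mul_integral_inv_le_of_lt hn hQ hQ' hφ ha hab hb h1
  by_cases h2 : (b - a) * ∫ x in Icc 0 1, (φ x)⁻¹ < ∫ t in Icc a b, (ψ t)⁻¹
  · have hr : ∀ f : ℝ → ℝ, ∫ t in Icc (1 - b) (1 - a), f (1 - t) = ∫ t in Icc a b, f t := by
      intro f
      rw [← hI f _ _ hab.le, ← hI (fun t => f (1 - t)) _ _ (by linarith),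
        intervalIntegral.integral_comp_sub_left f]
      simp
    have e : 1 - a - (1 - b) = b - a := by ring
    have := (h.inv_comp_one_sub hφ.1).integral_mul_integral_inv_le_of_lt hn hQ hQ'
      (inv_mem_dyadicA2 hφ) (a := 1 - b) (b := 1 - a) (by linarith) (by linarith) (by linarith)
      (by rw [e, hr (fun t => (ψ t)⁻¹)]; exact h2)
    rw [e, hr (fun t => (ψ t)⁻¹), hr (fun t => ((ψ t)⁻¹)⁻¹)] at this
    simp only [inv_inv] at this
    linarith
  · push Not at h1 h2
    have hQQ' : Q ≤ Q' := by
      refine le_trans ?_ hQ'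
      rw [le_div_iff₀ (by positivity)]
      nlinarith [sq_nonneg ((2 : ℝ) ^ n - 1)]
    have hx : (∫ x in Icc 0 1, φ x) * (∫ x in Icc 0 1, (φ x)⁻¹) ≤ Q := by
      have hmem : (0 : Fin n → ℝ) ∈ dyadicCell 0 (0 : Fin n → ℕ) := by
        rw [mem_dyadicCell_iff]
        exact ⟨fun i => le_rfl, by ext; simp [dyadicIndex]⟩
      have := integral_mul_integral_inv_dyadicCell_le hφ 0 hmem
      rw [dyadicIndex_zero hmem, setIntegral_congr_set (dyadicCell_zero_ae_eq n),
        setIntegral_congr_set (dyadicCell_zero_ae_eq n)] at this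
      simpa using this
    have hsub : Icc a b ⊆ Ioo 0 1 := fun t ht => ⟨ha.trans_le ht.1, ht.2.trans_lt hb⟩
    have hnn : 0 ≤ ∫ t in Icc a b, (ψ t)⁻¹ :=
      setIntegral_nonneg measurableSet_Icc fun t ht => (inv_pos.2 (h.pos hφ.1 (hsub ht))).le
    have hnn' : 0 ≤ ∫ x in Icc 0 1, φ x :=
      integral_nonneg_of_ae (hφ.1.mono fun x hx => hx.le)
    calc _ ≤ ((b - a) * ∫ x in Icc 0 1, φ x) * ((b - a) * ∫ x in Icc 0 1, (φ x)⁻¹) :=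
          mul_le_mul h1 h2 hnn (mul_nonneg (by linarith) hnn')
      _ = (∫ x in Icc 0 1, φ x) * (∫ x in Icc 0 1, (φ x)⁻¹) * (b - a) ^ 2 := by ring
      _ ≤ Q' * (b - a) ^ 2 := by gcongr; linarith

/-- A monotonic rearrangement of a dyadic `A₂` weight is an `A₂` weight on the interval. -/
theorem mem_intervalA2 (h : IsMonotonicRearrangement φ ψ) (hn : 1 ≤ n)
    {Q Q' : ℝ} (hQ : 1 ≤ Q)
    (hQ' : (Q * (2 ^ n + 1) ^ 2 - (2 ^ n - 1) ^ 2) / (4 * 2 ^ n) ≤ Q')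
    (hφ : φ ∈ dyadicA2 n Q) : ψ ∈ intervalA2 Q' := by
  have hi := h.integrableOn hφ.2.1
  have hi' := h.integrableOn_inv hφ.2.2.1
  refine ⟨h.ae_pos hφ.1, hi, hi', ?_⟩
  rintro I ⟨a, b, ha, hab, hb, rfl⟩
  have hvol : volume.real (Icc a b) = b - a := by simp [hab.le]
  have hba : 0 < b - a := by linarith
  rw [setAverage_eq, setAverage_eq, hvol, integral_Icc_eq_integral_Ioc,
    integral_Icc_eq_integral_Ioc, ← intervalIntegral.integral_of_le hab.le,
    ← intervalIntegral.integral_of_le hab.le, smul_eq_mul, smul_eq_mul]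
  suffices hs : (∫ t in a..b, ψ t) * (∫ t in a..b, (ψ t)⁻¹) ≤ Q' * (b - a) ^ 2 by
    have : (b - a)⁻¹ * (∫ t in a..b, ψ t) * ((b - a)⁻¹ * ∫ t in a..b, (ψ t)⁻¹) =
        (∫ t in a..b, ψ t) * (∫ t in a..b, (ψ t)⁻¹) / (b - a) ^ 2 := by field_simp
    rw [this, div_le_iff₀ (by positivity)]
    exact hs
  -- approximate `[a, b]` by the intervals between `a + ε (b - a)` and `b - ε (b - a)`
  have hlim : ∀ f : ℝ → ℝ, IntegrableOn f (Icc 0 1) → Filter.Tendsto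
      (fun ε : ℝ => ∫ t in (a + ε * (b - a))..(b - ε * (b - a)), f t)
      (nhdsWithin 0 (Ioo 0 (1 / 2))) (nhds (∫ t in a..b, f t)) := by
    intro f hf
    have hII : ∀ x ∈ Icc (0 : ℝ) 1, ∀ y ∈ Icc (0 : ℝ) 1, IntervalIntegrable f volume x y :=
      fun x hx y hy => (intervalIntegrable_iff_integrableOn_Icc_of_le zero_le_one).2 hf |>.mono_set
        (by rw [uIcc_of_le zero_le_one]; exact uIcc_subset_Icc hx hy)
    have hprim : ContinuousOn (fun x => ∫ t in (0 : ℝ)..x, f t) (Icc 0 1) :=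
      intervalIntegral.continuousOn_primitive_interval (by rwa [uIcc_of_le zero_le_one])
        |>.mono (by rw [uIcc_of_le zero_le_one])
    have hA : ∀ ε ∈ Ioo (0 : ℝ) (1 / 2), a + ε * (b - a) ∈ Icc (0 : ℝ) 1 ∧
        b - ε * (b - a) ∈ Icc (0 : ℝ) 1 := by
      intro ε hε
      have h1 := mul_pos hε.1 hba
      have h2 := mul_lt_mul_of_pos_right hε.2 hba
      constructor <;> constructor <;> linarith
    have ha' : a ∈ Icc (0 : ℝ) 1 := ⟨ha, by linarith⟩
    have hb' : b ∈ Icc (0 : ℝ) 1 := ⟨by linarith, hb⟩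
    have t1 : Filter.Tendsto (fun ε : ℝ => a + ε * (b - a)) (nhdsWithin 0 (Ioo 0 (1 / 2)))
        (nhdsWithin a (Icc 0 1)) := by
      refine tendsto_nhdsWithin_iff.2 ⟨?_, ?_⟩
      · exact (Continuous.tendsto' (by fun_prop) 0 a (by simp)).mono_left nhdsWithin_le_nhds
      · exact Filter.eventually_of_mem self_mem_nhdsWithin fun ε hε => (hA ε hε).1
    have t2 : Filter.Tendsto (fun ε : ℝ => b - ε * (b - a)) (nhdsWithin 0 (Ioo 0 (1 / 2)))
        (nhdsWithin b (Icc 0 1)) := by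
      refine tendsto_nhdsWithin_iff.2 ⟨?_, ?_⟩
      · exact (Continuous.tendsto' (by fun_prop) 0 b (by simp)).mono_left nhdsWithin_le_nhds
      · exact Filter.eventually_of_mem self_mem_nhdsWithin fun ε hε => (hA ε hε).2
    have h0 : (0 : ℝ) ∈ Icc (0 : ℝ) 1 := ⟨le_rfl, zero_le_one⟩
    rw [← intervalIntegral.integral_interval_sub_left (hII 0 h0 b hb') (hII 0 h0 a ha')]
    refine Filter.Tendsto.congr' ?_
      (((hprim b hb').tendsto.comp t2).sub ((hprim a ha').tendsto.comp t1))
    refine Filter.eventually_of_mem self_mem_nhdsWithin fun ε hε => ?_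
    exact intervalIntegral.integral_interval_sub_left (hII 0 h0 _ (hA ε hε).2)
      (hII 0 h0 _ (hA ε hε).1)
  have hne : (nhdsWithin (0 : ℝ) (Ioo 0 (1 / 2))).NeBot := by
    rw [nhdsWithin_Ioo_eq_nhdsGT (by norm_num)]; infer_instance
  have hrhs : Filter.Tendsto (fun ε : ℝ => Q' * ((b - ε * (b - a)) - (a + ε * (b - a))) ^ 2)
      (nhdsWithin 0 (Ioo 0 (1 / 2))) (nhds (Q' * (b - a) ^ 2)) :=
    (Continuous.tendsto' (by fun_prop) 0 _ (by simp)).mono_left nhdsWithin_le_nhds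
  refine le_of_tendsto_of_tendsto ((hlim _ hi).mul (hlim _ hi')) hrhs ?_
  refine Filter.eventually_of_mem self_mem_nhdsWithin fun ε hε => ?_
  have h1 := mul_pos hε.1 hba
  have h2 := mul_lt_mul_of_pos_right hε.2 hba
  exact h.intervalIntegral_mul_intervalIntegral_inv_le hn hQ hQ' hφ (by linarith) (by linarith)
    (by linarith)

end IsMonotonicRearrangement

/-! ### Existence of the rearrangement. -/

/-- Right continuity of the distribution function makes the infimum attained. -/
lemma quantile_le_iff (μ : Measure ℝ) [IsProbabilityMeasure μ] {t y : ℝ} (ht : t ∈ Ioo (0 : ℝ) 1) :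
    sInf {z | 1 - t ≤ ProbabilityTheory.cdf μ z} ≤ y ↔ 1 - t ≤ ProbabilityTheory.cdf μ y := by
  set F := ProbabilityTheory.cdf μ with hF
  have hne : {z | 1 - t ≤ F z}.Nonempty :=
    ((ProbabilityTheory.tendsto_cdf_atTop μ).eventually_const_le
      (by linarith [ht.1] : 1 - t < 1)).exists
  have hbdd : BddBelow {z | 1 - t ≤ F z} := by
    obtain ⟨y₀, hy₀⟩ := ((ProbabilityTheory.tendsto_cdf_atBot μ).eventually_lt_const
      (by linarith [ht.2] : 0 < 1 - t)).exists
    refine ⟨y₀, fun z hz => ?_⟩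
    by_contra! hlt
    exact absurd (F.mono hlt.le) (not_le.2 (hy₀.trans_le hz))
  refine ⟨fun h => ?_, fun h => csInf_le hbdd h⟩
  have hlim : Filter.Tendsto F (nhdsWithin y (Ioi y)) (nhds (F y)) :=
    (F.right_continuous y).mono_left (nhdsWithin_mono _ Ioi_subset_Ici_self)
  refine ge_of_tendsto hlim (Filter.eventually_of_mem self_mem_nhdsWithin fun z hz => ?_)
  obtain ⟨s, hs, hsz⟩ := exists_lt_of_csInf_lt hne (h.trans_lt hz)
  exact le_trans hs (F.mono hsz.le)

/-- Existence of the monotonic rearrangement, as a quantile function. -/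
theorem exists_isMonotonicRearrangement {n : ℕ} {φ : (Fin n → ℝ) → ℝ}
    (hφ : AEMeasurable φ (volume.restrict (Icc (0 : Fin n → ℝ) 1))) :
    ∃ ψ, IsMonotonicRearrangement φ ψ := by
  have hP : IsProbabilityMeasure (volume.restrict (Icc (0 : Fin n → ℝ) 1)) :=
    ⟨by simp [Real.volume_Icc_pi]⟩
  have hμ := Measure.isProbabilityMeasure_map hφ
  set μ := (volume.restrict (Icc (0 : Fin n → ℝ) 1)).map φ with hμdef
  set ψ : ℝ → ℝ := fun t => sInf {z | 1 - t ≤ ProbabilityTheory.cdf μ z} with hψ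
  have hanti : AntitoneOn ψ (Ioo 0 1) := by
    intro s hs t ht hst
    rw [hψ, quantile_le_iff μ ht]
    have := (quantile_le_iff μ hs).1 le_rfl
    linarith
  have hres : volume.restrict (Icc (0 : ℝ) 1) = volume.restrict (Ioo 0 1) :=
    Measure.restrict_congr_set Ioo_ae_eq_Icc.symm
  have hψm : AEMeasurable ψ (volume.restrict (Icc (0 : ℝ) 1)) :=
    hres ▸ aemeasurable_restrict_of_antitoneOn measurableSet_Ioo hanti
  refine ⟨ψ, hanti, hφ, hψm, Measure.ext_of_Iic _ _ fun y => ?_⟩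
  rw [← hμdef, Measure.map_apply_of_aemeasurable hψm measurableSet_Iic, hres,
    Measure.restrict_apply₀' measurableSet_Ioo.nullMeasurableSet, ← ProbabilityTheory.ofReal_cdf]
  have hF0 := ProbabilityTheory.cdf_nonneg μ y
  have hF1 := ProbabilityTheory.cdf_le_one μ y
  set c := ProbabilityTheory.cdf μ y with hc
  have h1 : Ioo (1 - c) 1 ⊆ ψ ⁻¹' Iic y ∩ Ioo 0 1 := by
    intro t ht
    have ht' : t ∈ Ioo (0 : ℝ) 1 := ⟨by linarith [ht.1], ht.2⟩
    exact ⟨(quantile_le_iff μ ht').2 (by linarith [ht.1]), ht'⟩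
  have h2 : ψ ⁻¹' Iic y ∩ Ioo 0 1 ⊆ Icc (1 - c) 1 := by
    rintro t ⟨ht, ht'⟩
    have := (quantile_le_iff μ ht').1 ht
    exact ⟨by linarith, ht'.2.le⟩
  have e1 : volume (Ioo (1 - c) 1) = ENNReal.ofReal c := by simp
  have e2 : volume (Icc (1 - c) 1) = ENNReal.ofReal c := by simp
  exact le_antisymm (e1 ▸ measure_mono h1) (e2 ▸ measure_mono h2)

/-! ### The extremal step function on the interval. -/

/-- The step function equal to `s ^ k` on `(N ^ (-k - 1), N ^ (-k)]`, for all integers `k`. -/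
noncomputable def stepWeight (N : ℕ) (s t : ℝ) : ℝ := s ^ Int.log N t⁻¹

section stepWeight

variable {N : ℕ} {s t : ℝ}

lemma stepWeight_pos (hs : 0 < s) (t : ℝ) : 0 < stepWeight N s t := zpow_pos hs _

lemma stepWeight_inv (s t : ℝ) : stepWeight N s⁻¹ t = (stepWeight N s t)⁻¹ := inv_zpow _ _

lemma stepWeight_eq (hN : 1 < N) {k : ℤ} (ht : 0 < t) (h₁ : (N : ℝ) ^ k ≤ t⁻¹)
    (h₂ : t⁻¹ < (N : ℝ) ^ (k + 1)) : stepWeight N s t = s ^ k := by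
  have ht' : 0 < t⁻¹ := inv_pos.2 ht
  have h₃ := (Int.zpow_le_iff_le_log hN ht').1 h₁
  have h₄ := (Int.lt_zpow_iff_log_lt hN ht').1 h₂
  rw [stepWeight, show Int.log N t⁻¹ = k by omega]

lemma stepWeight_mul_pow (hN : 1 < N) (hs : 0 < s) (ht : 0 < t) (k : ℕ) :
    stepWeight N s (t * ((N : ℝ) ^ k)⁻¹) = s ^ k * stepWeight N s t := by
  have hN0 : (0 : ℝ) < N := by exact_mod_cast (by omega : 0 < N)
  have ht' : 0 < t⁻¹ := inv_pos.2 ht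
  have hk : (0 : ℝ) < (N : ℝ) ^ k := by positivity
  have h₁ := (Int.zpow_le_iff_le_log hN ht').2 le_rfl
  have h₂ := (Int.lt_zpow_iff_log_lt hN ht').2 (lt_add_one _)
  rw [stepWeight_eq hN (k := k + Int.log N t⁻¹) (by positivity), zpow_add₀ hs.ne', zpow_natCast,
    stepWeight]
  · rw [zpow_add₀ hN0.ne', zpow_natCast, mul_inv, inv_inv, mul_comm]
    gcongr
  · rw [add_assoc, zpow_add₀ hN0.ne', zpow_natCast, mul_inv, inv_inv, mul_comm]
    gcongr

lemma antitoneOn_stepWeight (hs : 1 ≤ s) : AntitoneOn (stepWeight N s) (Ioi 0) := by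
  intro x hx y hy hxy
  exact zpow_le_zpow_right₀ hs (Int.log_mono_right (inv_pos.2 hy) (inv_anti₀ hx hxy))

lemma aemeasurable_stepWeight (hs : 1 ≤ s) :
    AEMeasurable (stepWeight N s) (volume.restrict (Icc 0 1)) := by
  rw [← Measure.restrict_congr_set (Ioc_ae_eq_Icc (a := (0 : ℝ)) (b := 1))]
  exact aemeasurable_restrict_of_antitoneOn measurableSet_Ioc
    ((antitoneOn_stepWeight hs).mono Ioc_subset_Ioi_self)

/-- Gives integrability: the exponent exceeds -1 exactly when s < N. -/
lemma stepWeight_le_rpow (hN : 1 < N) (hs : 1 ≤ s) (ht : 0 < t) :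
    stepWeight N s t ≤ t ^ (-Real.logb N s) := by
  have hN1 : (1 : ℝ) < N := by exact_mod_cast hN
  have h₁ := (Int.zpow_le_iff_le_log hN (inv_pos.2 ht)).2 le_rfl
  have h := Real.rpow_le_rpow (by positivity) h₁ (Real.logb_nonneg hN1 hs)
  rw [← Real.rpow_intCast, ← Real.rpow_mul (by positivity), mul_comm, Real.rpow_mul (by positivity),
    Real.rpow_logb (by positivity) hN1.ne' (by positivity), Real.rpow_intCast,
    Real.inv_rpow ht.le, ← Real.rpow_neg ht.le] at h
  exact h

lemma integrableOn_stepWeight (hN : 1 < N) (hs : 1 ≤ s) (hsN : s < N) :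
    IntegrableOn (stepWeight N s) (Icc 0 1) := by
  have hN1 : (1 : ℝ) < N := by exact_mod_cast hN
  have hm := aemeasurable_stepWeight (N := N) hs
  have hres : volume.restrict (Icc (0 : ℝ) 1) = volume.restrict (Ioo 0 1) :=
    Measure.restrict_congr_set Ioo_ae_eq_Icc.symm
  rw [hres] at hm
  rw [IntegrableOn, hres]
  have hσ : -1 < -Real.logb N s := by
    rw [neg_lt_neg_iff, Real.logb_lt_iff_lt_rpow hN1 (by linarith), Real.rpow_one]
    exact hsN
  refine ((intervalIntegral.integrableOn_Ioo_rpow_iff one_pos).2 hσ).mono' hm.aestronglyMeasurable ?_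
  filter_upwards [ae_restrict_mem measurableSet_Ioo] with t ht
  rw [Real.norm_of_nonneg (stepWeight_pos (by linarith) t).le]
  exact stepWeight_le_rpow hN hs ht.1

lemma integrableOn_stepWeight_inv (hs : 1 ≤ s) :
    IntegrableOn (fun t => (stepWeight N s t)⁻¹) (Icc 0 1) := by
  refine Integrable.mono' (g := fun _ => (1 : ℝ)) (integrable_const _)
    (aemeasurable_stepWeight hs).inv.aestronglyMeasurable ?_
  rw [← Measure.restrict_congr_set (Ioc_ae_eq_Icc (a := (0 : ℝ)) (b := 1))]
  filter_upwards [ae_restrict_mem measurableSet_Ioc] with t ht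
  rw [Real.norm_of_nonneg (inv_pos.2 (stepWeight_pos (by linarith) t)).le]
  refine inv_le_one_of_one_le₀ ?_
  have := antitoneOn_stepWeight (N := N) hs ht.1 (mem_Ioi.2 one_pos) ht.2
  simpa [stepWeight] using this

lemma intervalIntegral_stepWeight_pow (hN : 1 < N) (hs : 0 < s) (k : ℕ) :
    ∫ t in (0 : ℝ)..((N : ℝ) ^ k)⁻¹, stepWeight N s t =
      ((N : ℝ) ^ k)⁻¹ * s ^ k * ∫ t in (0 : ℝ)..1, stepWeight N s t := by
  have hk : (0 : ℝ) < (N : ℝ) ^ k := by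
    have : (0 : ℝ) < N := by exact_mod_cast (by omega : 0 < N)
    positivity
  have h := intervalIntegral.integral_comp_mul_right (a := 0) (b := 1) (stepWeight N s)
    (inv_pos.2 hk).ne'
  rw [zero_mul, one_mul, inv_inv, smul_eq_mul] at h
  have h' : ∫ t in (0 : ℝ)..1, stepWeight N s (t * ((N : ℝ) ^ k)⁻¹) =
      s ^ k * ∫ t in (0 : ℝ)..1, stepWeight N s t := by
    rw [← intervalIntegral.integral_const_mul]
    refine intervalIntegral.integral_congr_ae (.of_forall fun t ht => ?_)
    rw [uIoc_of_le zero_le_one] at ht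
    exact stepWeight_mul_pow hN hs ht.1 k
  rw [h'] at h
  rw [mul_assoc, h, inv_mul_cancel_left₀ hk.ne']

lemma intervalIntegral_stepWeight_of_inv_le (hN : 1 < N) {b : ℝ} (hb : (N : ℝ)⁻¹ ≤ b)
    (hb1 : b ≤ 1) : ∫ t in (N : ℝ)⁻¹..b, stepWeight N s t = b - (N : ℝ)⁻¹ := by
  have hN0 : (0 : ℝ) < N := by exact_mod_cast (by omega : 0 < N)
  rw [intervalIntegral.integral_congr_ae (g := fun _ => (1 : ℝ))]
  · simp
  refine .of_forall fun t ht => ?_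
  rw [uIoc_of_le hb] at ht
  have ht0 : 0 < t := (inv_pos.2 hN0).trans ht.1
  rw [stepWeight_eq hN (k := 0) ht0, zpow_zero]
  · simpa using one_le_inv_iff₀.2 ⟨ht0, ht.2.trans hb1⟩
  · simpa using (inv_lt_comm₀ ht0 hN0).2 ht.1

lemma intervalIntegral_stepWeight_eq (hN : 1 < N) (hs : 0 < s)
    (hi : IntegrableOn (stepWeight N s) (Icc 0 1)) {b : ℝ} (hb : (N : ℝ)⁻¹ ≤ b) (hb1 : b ≤ 1) :
    ∫ t in (0 : ℝ)..b, stepWeight N s t =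
      (N : ℝ)⁻¹ * s * (∫ t in (0 : ℝ)..1, stepWeight N s t) + (b - (N : ℝ)⁻¹) := by
  have hN0 : (0 : ℝ) < N := by exact_mod_cast (by omega : 0 < N)
  have hinv : 0 ≤ (N : ℝ)⁻¹ := (inv_pos.2 hN0).le
  have hII : ∀ x ∈ Icc (0 : ℝ) 1, ∀ y ∈ Icc (0 : ℝ) 1,
      IntervalIntegrable (stepWeight N s) volume x y :=
    fun x hx y hy => (intervalIntegrable_iff_integrableOn_Icc_of_le zero_le_one).2 hi |>.mono_set
      (by rw [uIcc_of_le zero_le_one]; exact uIcc_subset_Icc hx hy)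
  have h1 : (N : ℝ)⁻¹ ∈ Icc (0 : ℝ) 1 := ⟨hinv, hb.trans hb1⟩
  have hk := intervalIntegral_stepWeight_pow hN hs 1
  rw [pow_one, pow_one] at hk
  rw [← intervalIntegral.integral_add_adjacent_intervals
    (hII 0 ⟨le_rfl, zero_le_one⟩ _ h1) (hII _ h1 b ⟨hinv.trans hb, hb1⟩),
    intervalIntegral_stepWeight_of_inv_le hN hb hb1, hk]

/-- Self-similarity gives X = (s / N) X + (1 - 1 / N) for the integral X. -/
lemma intervalIntegral_stepWeight (hN : 1 < N) (hs : 0 < s) (hsN : s < N)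
    (hi : IntegrableOn (stepWeight N s) (Icc 0 1)) :
    ∫ t in (0 : ℝ)..1, stepWeight N s t = (N - 1) / (N - s) := by
  have hN1 : (1 : ℝ) < N := by exact_mod_cast hN
  have h := intervalIntegral_stepWeight_eq hN hs hi (inv_le_one_of_one_le₀ hN1.le) le_rfl
  rw [eq_div_iff (by linarith)]
  generalize ∫ t in (0 : ℝ)..1, stepWeight N s t = X at h ⊢
  field_simp at h
  linear_combination h

end stepWeight

/-! ### The extremal weight on the cube. -/

/-- The `n`-th power of the sup norm pushes the uniform measure on `[0,1]^n` to that on `[0,1]`. -/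
lemma measurePreserving_norm_pow {n : ℕ} (hn : n ≠ 0) :
    MeasurePreserving (fun x : Fin n → ℝ => ‖x‖ ^ n) (volume.restrict (Icc 0 1))
      (volume.restrict (Icc 0 1)) := by
  have hm : Measurable (fun x : Fin n → ℝ => ‖x‖ ^ n) := by fun_prop
  refine ⟨hm, ?_⟩
  have : IsFiniteMeasure (volume.restrict (Icc (0 : Fin n → ℝ) 1)) :=
    ⟨by simp [Real.volume_Icc_pi]⟩
  refine Measure.ext_of_Iic _ _ fun c => ?_
  rw [Measure.map_apply hm measurableSet_Iic, Measure.restrict_apply (hm measurableSet_Iic),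
    Measure.restrict_apply measurableSet_Iic]
  rcases lt_or_ge c 0 with hc | hc
  · have e1 : (fun x : Fin n → ℝ => ‖x‖ ^ n) ⁻¹' Iic c ∩ Icc 0 1 = ∅ := by
      refine eq_empty_of_forall_notMem fun x hx => ?_
      have : ‖x‖ ^ n ≤ c := hx.1
      linarith [pow_nonneg (norm_nonneg x) n]
    have e2 : Iic c ∩ Icc (0 : ℝ) 1 = ∅ := by
      refine eq_empty_of_forall_notMem fun x hx => ?_
      have h1 : x ≤ c := hx.1
      linarith [hx.2.1]
    rw [e1, e2, measure_empty, measure_empty]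
  -- Capping at 1 absorbs the restriction to the unit cube, so both sides are boxes.
  · set d := min c 1 with hd
    have hd0 : 0 ≤ d := le_min hc zero_le_one
    have hd1 : d ≤ 1 := min_le_right _ _
    have hr0 : 0 ≤ d ^ (n : ℝ)⁻¹ := Real.rpow_nonneg hd0 _
    have hrn : (d ^ (n : ℝ)⁻¹) ^ n = d := Real.rpow_inv_natCast_pow hd0 hn
    have e1 : (fun x : Fin n → ℝ => ‖x‖ ^ n) ⁻¹' Iic c ∩ Icc 0 1 =
        Icc 0 (fun _ => d ^ (n : ℝ)⁻¹) := by
      ext x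
      have key : 0 ≤ x → (‖x‖ ^ n ≤ d ↔ x ≤ fun _ => d ^ (n : ℝ)⁻¹) := by
        intro hx
        nth_rw 1 [← hrn]
        rw [pow_le_pow_iff_left₀ (norm_nonneg x) hr0 hn, pi_norm_le_iff_of_nonneg hr0, Pi.le_def]
        exact forall_congr' fun i => by rw [Real.norm_of_nonneg (hx i)]
      have hone : 0 ≤ x → (‖x‖ ^ n ≤ 1 ↔ x ≤ 1) := by
        intro hx
        rw [pow_le_one_iff_of_nonneg (norm_nonneg x) hn, pi_norm_le_iff_of_nonneg zero_le_one,
          Pi.le_def]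
        exact forall_congr' fun i => by rw [Real.norm_of_nonneg (hx i)]; rfl
      simp only [mem_inter_iff, mem_preimage, mem_Iic, mem_Icc]
      constructor
      · rintro ⟨h1, h2, h3⟩
        exact ⟨h2, (key h2).1 (le_min h1 ((hone h2).2 h3))⟩
      · rintro ⟨h1, h2⟩
        have := le_min_iff.1 ((key h1).2 h2)
        exact ⟨this.1, h1, (hone h1).1 this.2⟩
    have e2 : Iic c ∩ Icc (0 : ℝ) 1 = Icc 0 d := by
      ext x
      simp only [mem_inter_iff, mem_Iic, mem_Icc, hd, le_min_iff]
      tauto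
    rw [e1, e2, Real.volume_Icc_pi, Real.volume_Icc]
    simp only [Pi.zero_apply, sub_zero, Finset.prod_const, Finset.card_univ, Fintype.card_fin]
    rw [← ENNReal.ofReal_pow hr0, hrn]

/-- The radial weight on `[0,1]^n` whose monotonic rearrangement is `stepWeight`. -/
noncomputable def cubeWeight (n : ℕ) (s : ℝ) (x : Fin n → ℝ) : ℝ := stepWeight (2 ^ n) s (‖x‖ ^ n)

section cubeWeight

variable {n : ℕ} {s : ℝ}

lemma isMonotonicRearrangement_cubeWeight (hn : n ≠ 0) (hs : 1 ≤ s) :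
    IsMonotonicRearrangement (cubeWeight n s) (stepWeight (2 ^ n) s) := by
  have hmp := measurePreserving_norm_pow hn
  have hm := aemeasurable_stepWeight (N := 2 ^ n) hs
  refine ⟨(antitoneOn_stepWeight hs).mono Ioo_subset_Ioi_self,
    hm.comp_quasiMeasurePreserving hmp.quasiMeasurePreserving, hm, ?_⟩
  rw [← hmp.map_eq]
  rw [AEMeasurable.map_map_of_aemeasurable (hmp.map_eq.symm ▸ hm) hmp.aemeasurable]
  rfl

lemma setIntegral_comp_norm_pow_corner (hn : n ≠ 0) {f : ℝ → ℝ}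
    (hf : AEStronglyMeasurable f (volume.restrict (Icc 0 1))) (k : ℕ) :
    ∫ x in Icc (0 : Fin n → ℝ) (fun _ => ((2 : ℝ) ^ k)⁻¹), f (‖x‖ ^ n) =
      ∫ t in (0 : ℝ)..(((2 : ℝ) ^ n) ^ k)⁻¹, f t := by
  have hmp := measurePreserving_norm_pow hn
  have hc0 : (0 : ℝ) < (((2 : ℝ) ^ n) ^ k)⁻¹ := by positivity
  have hc1 : (((2 : ℝ) ^ n) ^ k)⁻¹ ≤ 1 :=
    inv_le_one_of_one_le₀ (one_le_pow₀ (one_le_pow₀ one_le_two))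
  have hr1 : ((2 : ℝ) ^ k)⁻¹ ≤ 1 := inv_le_one_of_one_le₀ (one_le_pow₀ one_le_two)
  have h := setIntegral_map (g := fun x : Fin n → ℝ => ‖x‖ ^ n)
    (measurableSet_Icc : MeasurableSet (Icc (0 : ℝ) (((2 : ℝ) ^ n) ^ k)⁻¹))
    (hmp.map_eq.symm ▸ hf) hmp.aemeasurable
  rw [hmp.map_eq, Measure.restrict_restrict measurableSet_Icc,
    Measure.restrict_restrict (hmp.measurable measurableSet_Icc)] at h
  have e1 : Icc (0 : ℝ) (((2 : ℝ) ^ n) ^ k)⁻¹ ∩ Icc 0 1 = Icc 0 (((2 : ℝ) ^ n) ^ k)⁻¹ :=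
    inter_eq_left.2 (Icc_subset_Icc_right hc1)
  have e2 : (fun x : Fin n → ℝ => ‖x‖ ^ n) ⁻¹' Icc 0 (((2 : ℝ) ^ n) ^ k)⁻¹ ∩ Icc 0 1 =
      Icc 0 (fun _ => ((2 : ℝ) ^ k)⁻¹) := by
    ext x
    have key : 0 ≤ x → (‖x‖ ^ n ≤ (((2 : ℝ) ^ n) ^ k)⁻¹ ↔ x ≤ fun _ => ((2 : ℝ) ^ k)⁻¹) := by
      intro hx
      rw [pow_right_comm, ← inv_pow, pow_le_pow_iff_left₀ (norm_nonneg x) (by positivity) hn,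
        pi_norm_le_iff_of_nonneg (by positivity), Pi.le_def]
      exact forall_congr' fun i => by rw [Real.norm_of_nonneg (hx i)]
    simp only [mem_inter_iff, mem_preimage, mem_Icc]
    constructor
    · rintro ⟨⟨-, h1⟩, h2, -⟩
      exact ⟨h2, (key h2).1 h1⟩
    · rintro ⟨h1, h2⟩
      exact ⟨⟨by positivity, (key h1).2 h2⟩, h1, fun i => (h2 i).trans hr1⟩
  rw [e1, e2] at h
  rw [← h, intervalIntegral.integral_of_le hc0.le, integral_Icc_eq_integral_Ioc]

/-- Away from the corner cubes, `cubeWeight` is constant on dyadic cubes. -/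
lemma exists_cubeWeight_eq_const {k : ℕ} {m : Fin n → ℕ} (hn : n ≠ 0) (hm : m ≠ 0) (s : ℝ) :
    ∃ j : ℤ, ∀ x ∈ univ.pi fun i => Ioc ((m i : ℝ) / 2 ^ k) (((m i : ℝ) + 1) / 2 ^ k),
      cubeWeight n s x = s ^ j := by
  obtain ⟨i₁, hi₁⟩ := Function.ne_iff.1 hm
  have : Nonempty (Fin n) := ⟨i₁⟩
  obtain ⟨i₀, hi₀⟩ := Finite.exists_max m
  have hM : m i₀ ≠ 0 := by
    have := hi₀ i₁
    simp only [Pi.zero_apply] at hi₁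
    omega
  set j := Nat.log 2 (m i₀) with hj
  have hj₁ : 2 ^ j ≤ m i₀ := Nat.pow_log_le_self 2 hM
  have hj₂ : m i₀ + 1 ≤ 2 ^ (j + 1) := Nat.lt_pow_succ_log_self (by norm_num) _
  have hj₁' : (2 : ℝ) ^ j ≤ m i₀ := by exact_mod_cast hj₁
  have hj₂' : (m i₀ : ℝ) + 1 ≤ 2 ^ (j + 1) := by exact_mod_cast hj₂
  -- The largest index m i₀ is in [2^j, 2^(j+1)), so ‖x‖ is in (2^(j-k), 2^(j+1-k)]: a single layer
  -- of the step function.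
  refine ⟨k - j - 1, fun x hx => ?_⟩
  rw [mem_univ_pi] at hx
  have hlow : (2 : ℝ) ^ j / 2 ^ k < ‖x‖ := by
    calc (2 : ℝ) ^ j / 2 ^ k ≤ m i₀ / 2 ^ k := by gcongr
      _ < x i₀ := (hx i₀).1
      _ ≤ ‖x i₀‖ := Real.le_norm_self _
      _ ≤ ‖x‖ := norm_le_pi_norm x i₀
  have hup : ‖x‖ ≤ (2 : ℝ) ^ (j + 1) / 2 ^ k := by
    rw [pi_norm_le_iff_of_nonneg (by positivity)]
    intro i
    have h0 : 0 ≤ x i := le_trans (by positivity) (hx i).1.le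
    rw [Real.norm_of_nonneg h0]
    refine (hx i).2.trans ?_
    have : (m i : ℝ) ≤ m i₀ := by exact_mod_cast hi₀ i
    gcongr
    linarith
  have hx0 : 0 < ‖x‖ := lt_trans (by positivity) hlow
  have h2 : ((2 : ℝ) ^ n) ≠ 0 := by positivity
  have hpow : ∀ e : ℤ, (((2 ^ n : ℕ) : ℝ)) ^ e = ((2 : ℝ) ^ e) ^ n := by
    intro e
    push_cast
    rw [← zpow_natCast, ← zpow_natCast, ← zpow_mul, ← zpow_mul, mul_comm]
  have h1n : 1 < 2 ^ n := Nat.one_lt_two_pow hn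
  refine stepWeight_eq h1n (by positivity) ?_ ?_
  · rw [hpow, ← inv_pow]
    refine pow_le_pow_left₀ (by positivity) ?_ n
    rw [le_inv_comm₀ (by positivity) hx0, ← zpow_neg]
    refine hup.trans_eq ?_
    rw [← zpow_natCast, ← zpow_natCast, ← zpow_sub₀ two_ne_zero]
    congr 1
    push_cast
    ring
  · rw [hpow, ← inv_pow]
    refine pow_lt_pow_left₀ ?_ (by positivity) hn
    rw [inv_lt_comm₀ hx0 (by positivity), ← zpow_neg]
    refine lt_of_eq_of_lt ?_ hlow
    rw [← zpow_natCast, ← zpow_natCast, ← zpow_sub₀ two_ne_zero]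
    congr 1
    ring

/-- On corner cubes the factors s^k and s^(-k) cancel and the product is exactly Q; on every other
dyadic cube the weight is almost everywhere constant and the product is 1. -/
lemma cubeWeight_mem_dyadicA2 (hn : n ≠ 0) {Q : ℝ} (hQ : 1 ≤ Q) (hs : 1 ≤ s) (hsN : s < 2 ^ n)
    (hsQ : (((2 : ℝ) ^ n - 1) / (2 ^ n - s)) * ((2 ^ n - 1) / (2 ^ n - s⁻¹)) = Q) :
    cubeWeight n s ∈ dyadicA2 n Q := by
  have hs0 : 0 < s := by linarith
  have h1n : 1 < 2 ^ n := Nat.one_lt_two_pow hn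
  have h1n' : (1 : ℝ) < 2 ^ n := by exact_mod_cast h1n
  have hmp := measurePreserving_norm_pow hn
  have hi : IntegrableOn (stepWeight (2 ^ n) s) (Icc 0 1) :=
    integrableOn_stepWeight h1n hs (by push_cast; exact hsN)
  have hi' : IntegrableOn (stepWeight (2 ^ n) s⁻¹) (Icc 0 1) := by
    simpa only [← stepWeight_inv] using integrableOn_stepWeight_inv (N := 2 ^ n) hs
  have hinv : ∀ x, (cubeWeight n s x)⁻¹ = cubeWeight n s⁻¹ x :=
    fun x => (stepWeight_inv _ _).symm
  simp only [dyadicA2, muckenhouptA2, mem_ofPred_eq, hinv]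
  refine ⟨.of_forall fun x => stepWeight_pos hs0 _, hmp.integrable_comp_of_integrable hi,
    hmp.integrable_comp_of_integrable hi', ?_⟩
  rintro I ⟨k, m, hm, rfl⟩
  have hk0 : (0 : ℝ) < (2 ^ n) ^ k := by positivity
  have hvol : volume.real (Icc (fun i => (m i : ℝ) / 2 ^ k) (fun i => ((m i : ℝ) + 1) / 2 ^ k)) =
      (((2 : ℝ) ^ n) ^ k)⁻¹ := by
    rw [← measureReal_dyadicCell m, measureReal_congr (dyadicCell_ae_eq m)]
  rw [setAverage_eq, setAverage_eq, hvol, inv_inv, smul_eq_mul, smul_eq_mul]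
  by_cases hm0 : m = 0
  · subst hm0
    have e : Icc (fun i => (((0 : Fin n → ℕ) i : ℕ) : ℝ) / 2 ^ k)
        (fun i => ((((0 : Fin n → ℕ) i : ℕ) : ℝ) + 1) / 2 ^ k) =
        Icc (0 : Fin n → ℝ) (fun _ => ((2 : ℝ) ^ k)⁻¹) := by
      congr 1 <;> ext i <;> simp
    have hX := intervalIntegral_stepWeight_pow h1n hs0 k
    have hY := intervalIntegral_stepWeight_pow h1n (inv_pos.2 hs0) k
    rw [intervalIntegral_stepWeight h1n hs0 (by push_cast; exact hsN) hi] at hX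
    rw [intervalIntegral_stepWeight h1n (inv_pos.2 hs0)
      (by push_cast; exact (inv_le_one_of_one_le₀ hs).trans_lt h1n') hi'] at hY
    push_cast at hX hY
    rw [e]
    simp only [cubeWeight]
    rw [setIntegral_comp_norm_pow_corner hn hi.aestronglyMeasurable,
      setIntegral_comp_norm_pow_corner hn hi'.aestronglyMeasurable, hX, hY, ← hsQ]
    refine le_of_eq ?_
    have hsk : s ^ k * s⁻¹ ^ k = 1 := by rw [← mul_pow, mul_inv_cancel₀ hs0.ne', one_pow]
    have hkk := mul_inv_cancel₀ hk0.ne'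
    generalize ((2 : ℝ) ^ n - 1) / (2 ^ n - s) = X
    generalize ((2 : ℝ) ^ n - 1) / (2 ^ n - s⁻¹) = Y
    generalize ((2 : ℝ) ^ n) ^ k = V at *
    calc V * (V⁻¹ * s ^ k * X) * (V * (V⁻¹ * s⁻¹ ^ k * Y))
        = (V * V⁻¹) * (V * V⁻¹) * (s ^ k * s⁻¹ ^ k) * (X * Y) := by ring
      _ = X * Y := by rw [hkk, hsk]; ring
  · have hae : (univ.pi fun i => Ioc ((m i : ℝ) / 2 ^ k) (((m i : ℝ) + 1) / 2 ^ k)) =ᵐ[volume]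
        Icc (fun i => (m i : ℝ) / 2 ^ k) (fun i => ((m i : ℝ) + 1) / 2 ^ k) := by
      rw [volume_pi]
      exact Measure.univ_pi_Ioc_ae_eq_Icc
    obtain ⟨j, hj⟩ := exists_cubeWeight_eq_const (k := k) hn hm0 s
    have hmeas : MeasurableSet
        (univ.pi fun i => Ioc ((m i : ℝ) / 2 ^ k) (((m i : ℝ) + 1) / 2 ^ k)) :=
      MeasurableSet.univ_pi fun _ => measurableSet_Ioc
    have hj' : ∀ x ∈ univ.pi fun i => Ioc ((m i : ℝ) / 2 ^ k) (((m i : ℝ) + 1) / 2 ^ k),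
        cubeWeight n s⁻¹ x = (s ^ j)⁻¹ := fun x hx => by rw [← hinv, hj x hx]
    rw [← setIntegral_congr_set hae, ← setIntegral_congr_set hae,
      setIntegral_congr_fun hmeas hj, setIntegral_congr_fun hmeas hj', setIntegral_const,
      setIntegral_const, measureReal_congr hae, hvol, smul_eq_mul, smul_eq_mul,
      mul_inv_cancel_left₀ hk0.ne', mul_inv_cancel_left₀ hk0.ne',
      mul_inv_cancel₀ (zpow_pos hs0 j).ne']
    exact hQ

end cubeWeight

/-! ### Sharpness and conclusion. -/

/-- The ratio of the geometric weight with `A₂` constant exactly `Q`. -/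
lemma exists_ratio {N Q : ℝ} (hN : 1 < N) (hQ : 1 ≤ Q) :
    ∃ s, 1 ≤ s ∧ s < N ∧ (N - 1) / (N - s) * ((N - 1) / (N - s⁻¹)) = Q := by
  -- The required equation cleared of denominators: the value is (Q - 1)(N - 1)² at s = 1 and -N(N -
  -- 1)² at s = N.
  have hcont : ContinuousOn (fun s : ℝ => Q * ((N - s) * (N * s - 1)) - s * (N - 1) ^ 2)
      (Icc 1 N) := by fun_prop
  have hN1 : 0 < (N - 1) ^ 2 := pow_pos (by linarith) 2
  obtain ⟨s, hs, h0⟩ := intermediate_value_Icc' hN.le hcont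
    (show (0 : ℝ) ∈ Icc _ _ by
      constructor
      · nlinarith [mul_pos (by linarith : 0 < N) hN1]
      · nlinarith [mul_nonneg (by linarith : 0 ≤ Q - 1) hN1.le])
  dsimp only at h0
  have hs0 : 0 < s := by linarith [hs.1]
  have hsN : s < N := by
    refine lt_of_le_of_ne hs.2 fun h => ?_
    subst h
    nlinarith [mul_pos hs0 hN1]
  have h2 : 0 < N - s⁻¹ := by linarith [inv_le_one_of_one_le₀ hs.1]
  have h3 : 0 < N - s := by linarith
  refine ⟨s, hs.1, hsN, ?_⟩
  rw [div_mul_div_comm, div_eq_iff (by positivity)]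
  have h4 : s * (N - s⁻¹) = N * s - 1 := by field_simp
  have : s * ((N - 1) * (N - 1)) = s * (Q * ((N - s) * (N - s⁻¹))) := by
    linear_combination -h0 - Q * (N - s) * h4
  exact mul_left_cancel₀ hs0.ne' this

lemma le_of_rearrangementActs {n : ℕ} (hn : n ≠ 0) {Q Q' : ℝ} (hQ : 1 ≤ Q)
    (h : RearrangementActs (dyadicA2 n Q) (intervalA2 Q')) :
    (Q * (2 ^ n + 1) ^ 2 - (2 ^ n - 1) ^ 2) / (4 * 2 ^ n) ≤ Q' := by
  have h1n : 1 < 2 ^ n := Nat.one_lt_two_pow hn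
  have h1n' : (1 : ℝ) < 2 ^ n := by exact_mod_cast h1n
  obtain ⟨s, hs, hsN, hsQ⟩ := exists_ratio h1n' hQ
  have hs0 : 0 < s := by linarith
  have hi : IntegrableOn (stepWeight (2 ^ n) s) (Icc 0 1) :=
    integrableOn_stepWeight h1n hs (by push_cast; exact hsN)
  have hi' : IntegrableOn (stepWeight (2 ^ n) s⁻¹) (Icc 0 1) := by
    simpa only [← stepWeight_inv] using integrableOn_stepWeight_inv (N := 2 ^ n) hs
  have hmem := (h _ (cubeWeight_mem_dyadicA2 hn hQ hs hsN hsQ)).2 _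
    (isMonotonicRearrangement_cubeWeight hn hs)
  have hX := intervalIntegral_stepWeight h1n hs0 (by push_cast; exact hsN) hi
  have hY := intervalIntegral_stepWeight h1n (inv_pos.2 hs0)
    (by push_cast; exact (inv_le_one_of_one_le₀ hs).trans_lt h1n') hi'
  -- This b makes the averages over [0, b] the midpoint of those over [0, 1] and [0, 1/N], matching
  -- t = 1/2 in the segment bound.
  set b : ℝ := 2 / (2 ^ n + 1) with hb
  have hb0 : 0 < b := by positivity
  have hb1 : b ≤ 1 := by rw [hb, div_le_one (by positivity)]; linarith
  have hbN : (((2 ^ n : ℕ) : ℝ))⁻¹ ≤ b := by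
    push_cast
    rw [hb, inv_eq_one_div, div_le_div_iff₀ (by positivity) (by positivity)]
    linarith
  have hA := intervalIntegral_stepWeight_eq h1n hs0 hi hbN hb1
  have hB := intervalIntegral_stepWeight_eq h1n (inv_pos.2 hs0) hi' hbN hb1
  have hprod := hmem.2.2.2 _ ⟨0, b, le_rfl, hb0, hb1, rfl⟩
  have hvol : volume.real (Icc 0 b) = b := by simp [hb0.le]
  simp only [← stepWeight_inv] at hprod
  rw [setAverage_eq, setAverage_eq, hvol, integral_Icc_eq_integral_Ioc,
    integral_Icc_eq_integral_Ioc, ← intervalIntegral.integral_of_le hb0.le,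
    ← intervalIntegral.integral_of_le hb0.le, smul_eq_mul, smul_eq_mul, hA, hB, hX, hY] at hprod
  push_cast at hprod
  refine le_trans (le_of_eq ?_) hprod
  have hs1 : s * s⁻¹ = 1 := mul_inv_cancel₀ hs0.ne'
  have hXs : ((2 : ℝ) ^ n - 1) / (2 ^ n - s) * (2 ^ n - s) = 2 ^ n - 1 :=
    div_mul_cancel₀ _ (by linarith)
  have hYs : ((2 : ℝ) ^ n - 1) / (2 ^ n - s⁻¹) * (2 ^ n - s⁻¹) = 2 ^ n - 1 :=
    div_mul_cancel₀ _ (by linarith [inv_le_one_of_one_le₀ hs])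
  rw [hb]
  generalize ((2 : ℝ) ^ n - 1) / (2 ^ n - s) = X at *
  generalize ((2 : ℝ) ^ n - 1) / (2 ^ n - s⁻¹) = Y at *
  generalize s⁻¹ = r at *
  generalize (2 : ℝ) ^ n = N at *
  have hN0 : N ≠ 0 := by linarith
  have hN1 : N + 1 ≠ 0 := by linarith
  have e1 : s * X = N * X - (N - 1) := by linear_combination -hXs
  have e2 : r * Y = N * Y - (N - 1) := by linear_combination -hYs
  -- The averages s X and r Y over [0, 1/N] also have product Q; comparison with X Y = Q gives `e4`.
  have e3 : (N * X - (N - 1)) * (N * Y - (N - 1)) = Q := by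
    rw [← e1, ← e2]; linear_combination hsQ + X * Y * hs1
  rw [mul_assoc N⁻¹, mul_assoc N⁻¹, e1, e2]
  have f : ∀ Z : ℝ, (2 / (N + 1))⁻¹ * (N⁻¹ * (N * Z - (N - 1)) + (2 / (N + 1) - N⁻¹)) =
      (N + 1) / 2 * (Z - 1) + 1 := by
    intro Z
    field_simp
    ring
  have e4 : N * ((X - 1) * (Y - 1)) = 1 - Q := by
    have : (N - 1) * (N * ((X - 1) * (Y - 1))) = (N - 1) * (1 - Q) := by
      linear_combination e3 - N * hsQ
    exact mul_left_cancel₀ (by linarith) this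
  rw [f, f, div_eq_iff (by positivity)]
  linear_combination -2 * N * (N + 1) * hsQ - (N - 1) * (N + 1) * e4

theorem corollary2 (n : ℕ) (hn : 1 ≤ n) (Q Q' : ℝ) (hQ : 1 ≤ Q) :
    RearrangementActs (dyadicA2 n Q) (intervalA2 Q') ↔
      (Q * (2 ^ n + 1) ^ 2 - (2 ^ n - 1) ^ 2) / 2 ^ (n + 2) ≤ Q' := by
  have e : (2 : ℝ) ^ (n + 2) = 4 * 2 ^ n := by rw [pow_add]; ring
  rw [e]
  refine ⟨le_of_rearrangementActs (by omega) hQ, fun hQ' φ hφ =>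
    ⟨exists_isMonotonicRearrangement hφ.2.1.aemeasurable, fun ψ h =>
      h.mem_intervalA2 hn hQ hQ' hφ⟩⟩
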